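/- Let $d \ge 5$ be an odd integer and let $q_d := \lfloor d/2 \rfloor + 1$. For a fixed integer $q$, the $q$-Coloring problem asks whether a given finite simple undirected graph has a proper $q$-coloring; $s$-SAT asks whether a given Boolean formula in conjunctive normal form with clauses of size at most $s$ is satisfiable. A path decomposition of a graph $G$ is a sequence of vertex sets (bags) such that every vertex of $G$ lies in some bag, both endpoints of every edge lie in a common bag, and the bags that contain a given vertex are consecutive; its width is the size of the largest bag minus one. A parameterized problem is solvable in time $\mathcal{O}^*(f(k))$ if a deterministic algorithm (a random access machine with logarithmic cost) solves every instance with parameter $k$ and input size $N$ in time $\mathcal{O}(f(k) \cdot N^{\mathcal{O}(1)})$. Assume the Strong Exponential Time Hypothesis (SETH): for every $\varepsilon > 0$ there is a constant $s$ such that $s$-SAT on $n$ variables cannot be solved in time $\mathcal{O}^*((2-\varepsilon)^n)$. Then there is no $\varepsilon > 0$ such that $q_d$-Coloring on graphs of maximum degree $d$, given along with a path decomposition of width $\mathrm{pw}$, can be solved in time $\mathcal{O}^*((\lfloor d/2 \rfloor + 1 - \varepsilon)^{\mathrm{pw}})$. -/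

import Mathlib

/-! ### A deterministic random access machine with logarithmic cost -/

namespace RAM

/-- The arithmetic operations of the machine on natural numbers (subtraction is truncated, division
is integer division). -/
inductive Op where
  | add
  | sub
  | mul
  | div

/-- The value of an arithmetic operation. -/
def Op.eval : Op → ℕ → ℕ → ℕ
  | .add, a, b => a + b
  | .sub, a, b => a - b
  | .mul, a, b => a * b
  | .div, a, b => a / b

/-- Programs of the random access machine in structured form. Registers and arrays are named by
natural numbers; a program is a finite object, so it mentions only finitely many of them. Array
cells are addressed indirectly, through the contents of a register. -/
inductive Prog where
  /-- do nothing -/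
  | skip
  /-- `x := k` -/
  | const (x k : ℕ)
  /-- `x := y o z` -/
  | arith (o : Op) (x y z : ℕ)
  /-- `x := a[y]` -/
  | load (x a y : ℕ)
  /-- `a[x] := y` -/
  | store (a x y : ℕ)
  /-- `P; Q` -/
  | seq (P Q : Prog)
  /-- `if x ≠ 0 then P else Q` -/
  | branch (x : ℕ) (P Q : Prog)
  /-- `while x ≠ 0 do P` -/
  | loop (x : ℕ) (P : Prog)

/-- A memory state: the contents of the registers and of the unbounded arrays. -/
structure Store where
  /-- the content of register `x` -/
  reg : ℕ → ℕ
  /-- the content of cell `i` of array `a` -/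
  arr : ℕ → ℕ → ℕ

/-- Overwrite register `x` by the value `v`. -/
def Store.setReg (s : Store) (x v : ℕ) : Store :=
  { s with reg := Function.update s.reg x v }

/-- Overwrite cell `i` of array `a` by the value `v`. -/
def Store.setArr (s : Store) (a i v : ℕ) : Store :=
  { s with arr := Function.update s.arr a (Function.update (s.arr a) i v) }

/-- `Exec P s t s'`: started in the state `s`, the program `P` halts in the state `s'` after time
`t`. Every executed instruction (and every evaluated test) costs one unit plus the number of bits
(`Nat.size`) of the addresses and values it handles. Execution is deterministic. -/
inductive Exec : Prog → Store → ℕ → Store → Prop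
  | skip (s : Store) : Exec .skip s 1 s
  | const (x k : ℕ) (s : Store) : Exec (.const x k) s (1 + k.size) (s.setReg x k)
  | arith (o : Op) (x y z : ℕ) (s : Store) :
      Exec (.arith o x y z) s (1 + (s.reg y).size + (s.reg z).size)
        (s.setReg x (o.eval (s.reg y) (s.reg z)))
  | load (x a y : ℕ) (s : Store) :
      Exec (.load x a y) s (1 + (s.reg y).size + (s.arr a (s.reg y)).size)
        (s.setReg x (s.arr a (s.reg y)))
  | store (a x y : ℕ) (s : Store) :
      Exec (.store a x y) s (1 + (s.reg x).size + (s.reg y).size)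
        (s.setArr a (s.reg x) (s.reg y))
  | seq {P Q : Prog} {s s' s'' : Store} {t t' : ℕ} :
      Exec P s t s' → Exec Q s' t' s'' → Exec (.seq P Q) s (t + t') s''
  | branch_true {x : ℕ} {P Q : Prog} {s s' : Store} {t : ℕ} :
      s.reg x ≠ 0 → Exec P s t s' → Exec (.branch x P Q) s (1 + (s.reg x).size + t) s'
  | branch_false {x : ℕ} {P Q : Prog} {s s' : Store} {t : ℕ} :
      s.reg x = 0 → Exec Q s t s' → Exec (.branch x P Q) s (1 + (s.reg x).size + t) s'
  | loop_true {x : ℕ} {P : Prog} {s s' s'' : Store} {t t' : ℕ} :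
      s.reg x ≠ 0 → Exec P s t s' → Exec (.loop x P) s' t' s'' →
      Exec (.loop x P) s (1 + (s.reg x).size + t + t') s''
  | loop_false {x : ℕ} {P : Prog} {s : Store} :
      s.reg x = 0 → Exec (.loop x P) s (1 + (s.reg x).size) s

open scoped Classical in
/-- The 0/1 matrix `M` with `r` rows and `c` columns as the content of an array, row by row: cell
`i * c + j` holds the entry in row `i` and column `j`, and all cells after the last entry are 0. -/
noncomputable def rowMajor {r c : ℕ} (M : Fin r → Fin c → Prop) (k : ℕ) : ℕ :=
  if ∃ (i : Fin r) (j : Fin c), k = i.val * c + j.val ∧ M i j then 1 else 0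

/-- The initial state for an input that consists of two numbers `n`, `m` (in registers 0 and 1) and
of two 0/1 matrices (in arrays 0 and 1); everything else is 0. -/
noncomputable def initial (n m : ℕ) {r₀ c₀ r₁ c₁ : ℕ} (M₀ : Fin r₀ → Fin c₀ → Prop)
    (M₁ : Fin r₁ → Fin c₁ → Prop) : Store where
  reg x := if x = 0 then n else if x = 1 then m else 0
  arr a := if a = 0 then rowMajor M₀ else if a = 1 then rowMajor M₁ else fun _ => 0

end RAM

/-! ### Parameterized decision problems and running times -/

/-- A parameterized decision problem, restricted to its valid instances. -/
structure ParamProblem where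
  /-- the instances -/
  Inst : Type
  /-- the instances that an algorithm has to handle -/
  Valid : Inst → Prop
  /-- the memory of the machine when it is started on an instance -/
  input : Inst → RAM.Store
  /-- the size of an instance (up to polynomial factors) -/
  size : Inst → ℕ
  /-- the parameter -/
  param : Inst → ℕ
  /-- the yes-instances -/
  Yes : Inst → Prop

/-- The problem can be solved in time `O*(b ^ param)`: some program halts on every valid instance
within time `C * b ^ param * (size + 1) ^ c`, for constants `C` and `c`, and its answer, which is
"yes" if register 0 is nonzero in the final state and "no" otherwise, is correct. -/
def ParamProblem.SolvableInOStar (A : ParamProblem) (b : ℝ) : Prop :=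
  ∃ (P : RAM.Prog) (C c : ℕ), ∀ I : A.Inst, A.Valid I →
    ∃ (t : ℕ) (s : RAM.Store), RAM.Exec P (A.input I) t s ∧ (s.reg 0 ≠ 0 ↔ A.Yes I) ∧
      (t : ℝ) ≤ C * b ^ A.param I * ((A.size I : ℝ) + 1) ^ c

/-! ### Satisfiability and the Strong Exponential Time Hypothesis -/

/-- A Boolean formula in conjunctive normal form. A clause is a set of literals; the literal
`(i, true)` is the variable `i`, and `(i, false)` is its negation. -/
structure CNF where
  /-- the number of variables -/
  numVars : ℕ
  /-- the number of clauses -/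
  numClauses : ℕ
  /-- the clauses -/
  clause : Fin numClauses → Finset (Fin numVars × Bool)

/-- The formula has a satisfying assignment. -/
def CNF.Satisfiable (φ : CNF) : Prop :=
  ∃ f : Fin φ.numVars → Bool, ∀ j, ∃ l ∈ φ.clause j, f l.1 = l.2

/-- `s`-SAT parameterized by the number of variables: satisfiability of formulas in conjunctive
normal form with clauses of size at most `s`. A formula is given by the number of variables, the
number of clauses, and the incidence matrices (clauses against variables) of the positive and of
the negative literals. -/
noncomputable def satProblem (s : ℕ) : ParamProblem where
  Inst := CNF
  Valid φ := ∀ j, (φ.clause j).card ≤ s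
  input φ := RAM.initial φ.numVars φ.numClauses
    (fun j i => (i, true) ∈ φ.clause j) (fun j i => (i, false) ∈ φ.clause j)
  size φ := φ.numVars + φ.numClauses
  param φ := φ.numVars
  Yes φ := φ.Satisfiable

/-- The Strong Exponential Time Hypothesis: for every `ε > 0` there is a constant `s` such that
`s`-SAT on `n` variables cannot be solved in time `O*((2 - ε) ^ n)`. -/
def SETH : Prop :=
  ∀ ε : ℝ, 0 < ε → ∃ s : ℕ, ¬ (satProblem s).SolvableInOStar (2 - ε)

/-! ### Graph coloring with a given path decomposition -/

/-- A graph together with a sequence of bags. -/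
structure BaggedGraph where
  /-- the number of vertices -/
  numVerts : ℕ
  /-- the graph -/
  graph : SimpleGraph (Fin numVerts)
  /-- the number of bags -/
  numBags : ℕ
  /-- the bags, from left to right -/
  bag : Fin numBags → Finset (Fin numVerts)

namespace BaggedGraph

/-- The sequence of bags is a path decomposition of the graph. -/
structure IsPathDecomposition (X : BaggedGraph) : Prop where
  /-- every vertex is in a bag -/
  vertex_mem : ∀ v, ∃ i, v ∈ X.bag i
  /-- the endpoints of every edge are in a common bag -/
  edge_mem : ∀ u v, X.graph.Adj u v → ∃ i, u ∈ X.bag i ∧ v ∈ X.bag i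
  /-- the bags that contain a vertex are consecutive -/
  interval : ∀ v i j k, i ≤ j → j ≤ k → v ∈ X.bag i → v ∈ X.bag k → v ∈ X.bag j

/-- The width of the sequence of bags: the size of the largest bag minus one. -/
def width (X : BaggedGraph) : ℕ :=
  (Finset.univ.sup fun i => (X.bag i).card) - 1

end BaggedGraph

open scoped Classical in
/-- `q`-Coloring on graphs of maximum degree `d` given along with a path decomposition,
parameterized by the width of that decomposition. An instance is given by the number of vertices,
the number of bags, the adjacency matrix, and the incidence matrix of bags against vertices. -/
noncomputable def coloringProblem (q d : ℕ) : ParamProblem where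
  Inst := BaggedGraph
  Valid X := X.graph.maxDegree = d ∧ X.IsPathDecomposition
  input X := RAM.initial X.numVerts X.numBags
    (fun u v => X.graph.Adj u v) (fun i v => v ∈ X.bag i)
  size X := X.numVerts + X.numBags
  param X := X.width
  Yes X := X.graph.Colorable q

/-! ### Basic facts on the random access machine -/

namespace RAM

/-! Put `q = d / 2 + 1`, so that `d = 2 * q - 1`. The proof reduces `s`-SAT to `q`-coloring. Given a
base `1 ≤ b < q`, there are `β`, `γ` and `a < 2` with `2 ^ β ≤ q ^ γ` and `b ^ γ ≤ a ^ β`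
(`exists_encoding_parameters`). The variables are split into about `n / β` groups, and the
assignment of a group is written in base `q` as the colors of `γ` tape vertices. A path
decomposition of width `γ * (n / β) + O(1)` then turns running time `b ^ pw` into `O(a ^ n)`,
against SETH.

The graph has one block for each triple of a clause, an assignment of a group, and a group, with the
group varying fastest. Cliques of size `q - 1` force the tape of a group to keep its colors from one
block of the group to the next (`tape_add_step`). Through the blocks of a clause runs a path of
flags and switches whose lists force some switch to have color 2 (`exists_switch`). This switch
fixes the colors along a wire and its probes, which force the tape to spell the assignment of that
block (`tape_of_switch`). Color 2 is only on the list if that assignment makes a literal of the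
clause true, so colorings give satisfying assignments; `isListColoring_encodeColor` is the converse.

Lists must be simulated without large degrees. Every gadget vertex gets its own palette of `q`
vertices. The first palette is a clique, and consecutive palettes are joined by a complete bipartite
graph minus a perfect matching, so all palettes carry the same bijection onto the colors. A palette
vertex then has degree at most `2 * (q - 1) + 1 = d`, and forbidding a color costs a gadget vertex
one edge (`encard_nbrs_le`).

Finally, a machine has to compute the reduction. Since `q`, `β`, `γ` are constants, adjacency and
bag membership are arithmetic expressions in the vertex and bag numbers and the input arrays; such
expressions are evaluated in polynomial time and tabulated (`exists_translation`). -/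

theorem Exec.pos {P : Prog} {s s' : Store} {t : ℕ} (h : Exec P s t s') : 0 < t := by
  induction h <;> omega

/-- A number above all names of registers and arrays that occur in a program. -/
def Prog.bound : Prog → ℕ
  | .skip => 0
  | .const x _ => x + 1
  | .arith _ x y z => x + y + z + 1
  | .load x a y => x + a + y + 1
  | .store a x y => a + x + y + 1
  | .seq P Q => P.bound + Q.bound
  | .branch x P Q => x + 1 + P.bound + Q.bound
  | .loop x P => x + 1 + P.bound

/-- Two states agree on all registers and arrays with names below `R`. -/
structure Store.AgreeBelow (R : ℕ) (s r : Store) : Prop where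
  reg : ∀ x < R, s.reg x = r.reg x
  arr : ∀ a < R, s.arr a = r.arr a

theorem Store.AgreeBelow.setReg {R : ℕ} {s r : Store} (h : s.AgreeBelow R r) (x v : ℕ) :
    (s.setReg x v).AgreeBelow R (r.setReg x v) :=
  ⟨fun y hy => by simp only [Store.setReg, Function.update_apply, h.reg y hy], h.arr⟩

theorem Store.AgreeBelow.setArr {R : ℕ} {s r : Store} (h : s.AgreeBelow R r) {a : ℕ} (ha : a < R)
    (i v : ℕ) : (s.setArr a i v).AgreeBelow R (r.setArr a i v) :=
  ⟨h.reg, fun b hb => by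
    simp only [Store.setArr, Function.update_apply, h.arr b hb, h.arr a ha]⟩

/-- The execution of a program depends only on the registers and arrays that it mentions. -/
theorem Exec.of_agreeBelow {P : Prog} {s s' : Store} {t R : ℕ} (h : Exec P s t s')
    (hP : P.bound ≤ R) {r : Store} (hr : s.AgreeBelow R r) :
    ∃ r', Exec P r t r' ∧ s'.AgreeBelow R r' := by
  induction h generalizing r with
  | skip s => exact ⟨r, .skip r, hr⟩
  | const x k s => exact ⟨_, .const x k r, hr.setReg x k⟩
  | arith o x y z s =>
    simp only [Prog.bound] at hP
    rw [hr.reg y (by omega), hr.reg z (by omega)]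
    exact ⟨_, .arith o x y z r, hr.setReg _ _⟩
  | load x a y s =>
    simp only [Prog.bound] at hP
    rw [hr.reg y (by omega), hr.arr a (by omega)]
    exact ⟨_, .load x a y r, hr.setReg _ _⟩
  | store a x y s =>
    simp only [Prog.bound] at hP
    rw [hr.reg y (by omega), hr.reg x (by omega)]
    exact ⟨_, .store a x y r, hr.setArr (by omega) _ _⟩
  | seq _ _ ih₁ ih₂ =>
    simp only [Prog.bound] at hP
    obtain ⟨r₁, h₁, a₁⟩ := ih₁ (by omega) hr
    obtain ⟨r₂, h₂, a₂⟩ := ih₂ (by omega) a₁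
    exact ⟨r₂, h₁.seq h₂, a₂⟩
  | branch_true hx _ ih =>
    simp only [Prog.bound] at hP
    obtain ⟨r₁, h₁, a₁⟩ := ih (by omega) hr
    rw [hr.reg _ (by omega)] at hx ⊢
    exact ⟨r₁, .branch_true hx h₁, a₁⟩
  | branch_false hx _ ih =>
    simp only [Prog.bound] at hP
    obtain ⟨r₁, h₁, a₁⟩ := ih (by omega) hr
    rw [hr.reg _ (by omega)] at hx ⊢
    exact ⟨r₁, .branch_false hx h₁, a₁⟩
  | loop_true hx _ _ ih₁ ih₂ =>
    have hP' := hP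
    simp only [Prog.bound] at hP
    obtain ⟨r₁, h₁, a₁⟩ := ih₁ (by omega) hr
    obtain ⟨r₂, h₂, a₂⟩ := ih₂ hP' a₁
    rw [hr.reg _ (by omega)] at hx ⊢
    exact ⟨r₂, .loop_true hx h₁ h₂, a₂⟩
  | loop_false hx =>
    simp only [Prog.bound] at hP
    rw [hr.reg _ (by omega)] at hx ⊢
    exact ⟨r, .loop_false hx, hr⟩

/-! ### Power bounds for running times -/

theorem size_le_self (n : ℕ) : n.size ≤ n := Nat.size_le.2 n.lt_two_pow_self

/-- All running times are bounded by a single power of a bound `V ≥ 2` on the numbers in the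
context. This inequality merges two such bounds into one, and its repeated use produces the nested
exponents below. -/
theorem pow_add_pow_le {V : ℕ} (hV : 2 ≤ V) (a b : ℕ) : V ^ a + V ^ b ≤ V ^ (a + b + 1) := by
  have h1 : V ^ a ≤ V ^ (a + b) := Nat.pow_le_pow_right (by omega) (by omega)
  have h2 : V ^ b ≤ V ^ (a + b) := Nat.pow_le_pow_right (by omega) (by omega)
  calc V ^ a + V ^ b ≤ V ^ (a + b) * 2 := by omega
    _ ≤ V ^ (a + b) * V := by gcongr
    _ = _ := (pow_succ _ _).symm

theorem le_pow_self {V : ℕ} (hV : 2 ≤ V) (k : ℕ) : k ≤ V ^ k :=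
  (Nat.lt_pow_self (by omega)).le

/-! ### Arithmetic expressions and their evaluation by straight-line programs -/

/-- The values of three variables and of two input arrays. -/
structure Ctx where
  /-- the variables -/
  var : Fin 3 → ℕ
  /-- the input arrays -/
  inp : Bool → ℕ → ℕ

/-- All numbers in the context are at most `V`. -/
structure Ctx.Le (Γ : Ctx) (V : ℕ) : Prop where
  var : ∀ i, Γ.var i ≤ V
  inp : ∀ b i, Γ.inp b i ≤ V

/-- Arithmetic expressions over three variables and two input arrays. -/
inductive Expr where
  | var (i : Fin 3)
  | const (k : ℕ)
  | op (o : Op) (a b : Expr)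
  | input (b : Bool) (a : Expr)

/-- The value of an expression. -/
def Expr.eval (Γ : Ctx) : Expr → ℕ
  | .var i => Γ.var i
  | .const k => k
  | .op o a b => o.eval (a.eval Γ) (b.eval Γ)
  | .input b a => Γ.inp b (a.eval Γ)

theorem Expr.exists_eval_le (e : Expr) :
    ∃ c : ℕ, ∀ (Γ : Ctx) (V : ℕ), 2 ≤ V → Γ.Le V → e.eval Γ ≤ V ^ c := by
  induction e with
  | var i => exact ⟨1, fun Γ V _ h => by simpa [eval] using h.var i⟩
  | const k => exact ⟨k, fun Γ V hV _ => le_pow_self hV k⟩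
  | input b a => exact ⟨1, fun Γ V _ h => by simpa [eval] using h.inp b _⟩
  | op o a b iha ihb =>
    obtain ⟨ca, ha⟩ := iha
    obtain ⟨cb, hb⟩ := ihb
    refine ⟨ca + cb + 1, fun Γ V hV h => ?_⟩
    have ha := ha Γ V hV h
    have hb := hb Γ V hV h
    have hs := pow_add_pow_le hV ca cb
    cases o with
    | add => exact (Nat.add_le_add ha hb).trans hs
    | sub => exact (Nat.sub_le _ _).trans (by omega)
    | div => exact (Nat.div_le_self _ _).trans (by omega)
    | mul =>
      calc a.eval Γ * b.eval Γ ≤ V ^ ca * V ^ cb := Nat.mul_le_mul ha hb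
        _ = V ^ (ca + cb) := (pow_add _ _ _).symm
        _ ≤ _ := Nat.pow_le_pow_right (by omega) (by omega)

/-- The context that a state holds: the variables are the registers `R`, `R + 1`, `R + 2`, and the
input arrays are `α false` and `α true`. -/
def Store.ctx (R : ℕ) (α : Bool → ℕ) (s : Store) : Ctx where
  var i := s.reg (R + i)
  inp b := s.arr (α b)

/-- The program that evaluates an expression into register `r`, using only registers from `r` on. -/
def Expr.compile (R : ℕ) (α : Bool → ℕ) : Expr → ℕ → Prog
  | .var i, r => .seq (.const r 0) (.arith .add r (R + i) r)
  | .const k, r => .const r k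
  | .op o a b, r => .seq (a.compile R α r) (.seq (b.compile R α (r + 1)) (.arith o r r (r + 1)))
  | .input b a, r => .seq (a.compile R α r) (.load r (α b) r)

/-- Registers are used as a stack: the value of a subexpression stays in `r` while the next one is
computed from `r + 1` on. As `R + 3 ≤ r`, the variables are never overwritten, so both operands are
evaluated in the same context. -/
theorem Expr.exec_compile (R : ℕ) (α : Bool → ℕ) (e : Expr) :
    ∃ c : ℕ, ∀ (r : ℕ) (s : Store), R + 3 ≤ r →
      ∃ t s', Exec (e.compile R α r) s t s' ∧ s'.arr = s.arr ∧
        s'.reg r = e.eval (s.ctx R α) ∧ (∀ x < r, s'.reg x = s.reg x) ∧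
        ∀ V, 2 ≤ V → (s.ctx R α).Le V → t ≤ V ^ c := by
  induction e with
  | var i =>
    refine ⟨3, fun r s hr => ⟨_, _, (Exec.const r 0 s).seq (.arith .add r (R + i) r _), rfl, ?_,
      fun x hx => ?_, fun V hV h => ?_⟩⟩
    · have : R + i.val ≠ r := by omega
      simp [Store.setReg, Expr.eval, Store.ctx, Op.eval, this]
    · simp [Store.setReg, hx.ne]
    · have : R + i.val ≠ r := by omega
      have h1 : (s.reg (R + i)).size ≤ V := (size_le_self _).trans (h.var i)
      simp only [Store.setReg, Function.update_self, Function.update_of_ne this, Nat.size_zero]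
      have : V * 4 ≤ V ^ 3 := by nlinarith [Nat.mul_le_mul hV hV]
      omega
  | const k =>
    refine ⟨k + 1, fun r s hr => ⟨_, _, Exec.const r k s, rfl, by simp [Store.setReg, Expr.eval],
      fun x hx => by simp [Store.setReg, hx.ne], fun V hV h => ?_⟩⟩
    have := size_le_self k
    have : k + 1 < V ^ (k + 1) := Nat.lt_pow_self (by omega)
    omega
  | op o a b iha ihb =>
    obtain ⟨ca, ha⟩ := iha
    obtain ⟨cb, hb⟩ := ihb
    obtain ⟨da, hda⟩ := a.exists_eval_le
    obtain ⟨db, hdb⟩ := b.exists_eval_le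
    refine ⟨(ca + cb + 1) + ((da + db + 1) + 0 + 1) + 1, fun r s hr => ?_⟩
    obtain ⟨ta, sa, ea, aa, va, ra, la⟩ := ha r s hr
    obtain ⟨tb, sb, eb, ab, vb, rb, lb⟩ := hb (r + 1) sa (by omega)
    have hctx : sa.ctx R α = s.ctx R α := by
      simp only [Store.ctx, aa, Ctx.mk.injEq, and_true]
      exact funext fun i => ra _ (by omega)
    rw [hctx] at vb lb
    refine ⟨_, _, ea.seq (eb.seq (.arith o r r (r + 1) sb)), ?_, ?_, fun x hx => ?_,
      fun V hV h => ?_⟩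
    · simp [Store.setReg, ab, aa]
    · simp [Store.setReg, vb, rb r (by omega), va, Expr.eval]
    · simp [Store.setReg, hx.ne, rb x (by omega), ra x hx]
    · rw [vb, rb r (by omega), va]
      have h1 := (size_le_self _).trans (hda _ V hV h)
      have h2 := (size_le_self _).trans (hdb _ V hV h)
      have h3 := la V hV h
      have h4 := lb V hV h
      have h5 := pow_add_pow_le hV ca cb
      have h6 := pow_add_pow_le hV da db
      have h7 := pow_add_pow_le hV (da + db + 1) 0
      have h8 := pow_add_pow_le hV (ca + cb + 1) ((da + db + 1) + 0 + 1)
      rw [pow_zero] at h7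
      omega
  | input b a iha =>
    obtain ⟨ca, ha⟩ := iha
    obtain ⟨da, hda⟩ := a.exists_eval_le
    refine ⟨ca + (da + 2 + 1) + 1, fun r s hr => ?_⟩
    obtain ⟨ta, sa, ea, aa, va, ra, la⟩ := ha r s hr
    refine ⟨_, _, ea.seq (.load r (α b) r sa), aa, ?_, fun x hx => ?_, fun V hV h => ?_⟩
    · simp [Store.setReg, aa, va, Expr.eval, Store.ctx]
    · simp [Store.setReg, hx.ne, ra x hx]
    · rw [va, aa]
      have h1 := (size_le_self _).trans (hda _ V hV h)
      have h2 : (s.arr (α b) (a.eval (s.ctx R α))).size ≤ V :=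
        (size_le_self _).trans (h.inp b _)
      have h3 := la V hV h
      have h4 := pow_add_pow_le hV da 2
      have h5 := pow_add_pow_le hV ca (da + 2 + 1)
      have : V * 2 ≤ V ^ 2 := by nlinarith
      omega

/-! ### Filling an array with the values of an expression -/

/-- The body of the loop of `fill`. -/
def fillStep (R : ℕ) (α : Bool → ℕ) (a : ℕ) (ev : Expr) : Prog :=
  .seq (ev.compile R α (R + 5)) (.seq (.store a (R + 2) (R + 5))
    (.seq (.arith .add (R + 2) (R + 2) (R + 4)) (.arith .sub (R + 3) (R + 3) (R + 4))))

/-- The program that stores in cell `i` of array `a`, for all `i` below the value of `eb`, the value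
of `ev` with the third variable set to `i`. -/
def fill (R : ℕ) (α : Bool → ℕ) (a : ℕ) (eb ev : Expr) : Prog :=
  .seq (.const (R + 2) 0) (.seq (eb.compile R α (R + 5)) (.seq (.arith .add (R + 3) (R + 5) (R + 2))
    (.seq (.const (R + 4) 1) (.loop (R + 3) (fillStep R α a ev)))))

/-- The context with two variables and the input arrays taken from a state, and the third variable
equal to `i`. -/
def Store.ctxAt (R : ℕ) (α : Bool → ℕ) (s : Store) (i : ℕ) : Ctx where
  var := ![s.reg R, s.reg (R + 1), i]
  inp b := s.arr (α b)

theorem Store.ctx_eq_ctxAt {R : ℕ} {α : Bool → ℕ} (s : Store) :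
    s.ctx R α = s.ctxAt R α (s.reg (R + 2)) := by
  simp only [Store.ctx, Store.ctxAt, Ctx.mk.injEq, and_true]
  funext i
  fin_cases i <;> rfl

theorem Store.ctxAt_congr {R : ℕ} {α : Bool → ℕ} {s s' : Store} (h₀ : s'.reg R = s.reg R)
    (h₁ : s'.reg (R + 1) = s.reg (R + 1)) (h : ∀ b, s'.arr (α b) = s.arr (α b)) (i : ℕ) :
    s'.ctxAt R α i = s.ctxAt R α i := by
  simp [Store.ctxAt, h₀, h₁, h]

/-- Register `R + 2` holds the current index and also serves as the third variable, `R + 3` counts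
the remaining iterations, `R + 4` holds the constant 1, and scratch space starts at `R + 5`. -/
theorem exec_fillStep (R : ℕ) (α : Bool → ℕ) (a : ℕ) (ev : Expr) :
    ∃ c : ℕ, ∀ s : Store, s.reg (R + 4) = 1 →
      ∃ t s', Exec (fillStep R α a ev) s t s' ∧
        s'.arr = Function.update s.arr a (Function.update (s.arr a) (s.reg (R + 2))
          (ev.eval (s.ctxAt R α (s.reg (R + 2))))) ∧
        s'.reg (R + 2) = s.reg (R + 2) + 1 ∧ s'.reg (R + 3) = s.reg (R + 3) - 1 ∧
        s'.reg (R + 4) = 1 ∧ (∀ x < R + 2, s'.reg x = s.reg x) ∧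
        ∀ V, 2 ≤ V → (s.ctxAt R α (s.reg (R + 2))).Le V → s.reg (R + 3) ≤ V → t ≤ V ^ c := by
  obtain ⟨c, hc⟩ := ev.exec_compile R α
  obtain ⟨e, he⟩ := ev.exists_eval_le
  refine ⟨c + (e + 5 + 1) + 1, fun s h1 => ?_⟩
  obtain ⟨t, s₁, e₁, a₁, v₁, r₁, l₁⟩ := hc (R + 5) s (by omega)
  rw [s.ctx_eq_ctxAt] at v₁ l₁
  refine ⟨_, _, e₁.seq ((Exec.store a (R + 2) (R + 5) s₁).seq
    ((Exec.arith .add (R + 2) (R + 2) (R + 4) _).seq (.arith .sub (R + 3) (R + 3) (R + 4) _))),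
    ?_, ?_, ?_, ?_, fun x hx => ?_, fun V hV h hk => ?_⟩
  · simp [Store.setReg, Store.setArr, a₁, v₁, r₁]
  · simp [Store.setReg, Store.setArr, r₁, h1, Op.eval]
  · simp [Store.setReg, Store.setArr, r₁, h1, Op.eval]
  · simp [Store.setReg, Store.setArr, r₁, h1]
  · simp [Store.setReg, Store.setArr, r₁ x (by omega), hx.ne, show x ≠ R + 3 by omega]
  · have hi : s.reg (R + 2) ≤ V := h.var 2
    have h2 := (size_le_self _).trans hi
    have h3 := (size_le_self _).trans hk
    have h4 := (size_le_self _).trans (he _ V hV h)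
    have h5 := l₁ V hV h
    have h6 := pow_add_pow_le hV e 5
    have h7 := pow_add_pow_le hV c (e + 5 + 1)
    have h8 : Nat.size 1 = 1 := by simp
    simp only [Store.setReg, Store.setArr, v₁, r₁ (R + 2) (by omega), r₁ (R + 3) (by omega),
      r₁ (R + 4) (by omega), h1, h8, ne_eq, Nat.add_left_cancel_iff, Nat.reduceEqDiff,
      not_false_eq_true, Function.update_of_ne]
    have : V * 16 ≤ V ^ 5 := by
      have := Nat.pow_le_pow_left hV 4
      calc V * 16 ≤ V * V ^ 4 := by gcongr
        _ = V ^ 5 := by ring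
    omega

/-- As the target `a` is not an input array, writing to it does not change the values of `ev` in
later rounds. The exponent `c` must not depend on the number `k` of rounds; `k` enters only as a
factor. -/
theorem exec_fill_loop (R : ℕ) {α : Bool → ℕ} {a : ℕ} (ha : ∀ b, α b ≠ a) (ev : Expr) :
    ∃ c : ℕ, ∀ (k : ℕ) (s : Store), s.reg (R + 4) = 1 → s.reg (R + 3) = k →
      ∃ t s', Exec (.loop (R + 3) (fillStep R α a ev)) s t s' ∧
        s'.arr = Function.update s.arr a (fun i =>
          if s.reg (R + 2) ≤ i ∧ i < s.reg (R + 2) + k then ev.eval (s.ctxAt R α i)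
          else s.arr a i) ∧
        (∀ x < R + 2, s'.reg x = s.reg x) ∧
        ∀ V, 2 ≤ V → (s.ctxAt R α (s.reg (R + 2) + k)).Le V → t ≤ (k + 1) * V ^ c := by
  obtain ⟨c, hc⟩ := exec_fillStep R α a ev
  refine ⟨c + 2 + 1, fun k => ?_⟩
  induction k with
  | zero =>
    intro s h1 hk
    refine ⟨_, s, Exec.loop_false hk, ?_, fun _ _ => rfl, fun V hV _ => ?_⟩
    · have : ∀ i, ¬ (s.reg (R + 2) ≤ i ∧ i < s.reg (R + 2) + 0) := fun i => by omega
      simp only [this, if_false]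
      exact (Function.update_eq_self a s.arr).symm
    · rw [hk]
      simp only [Nat.size_zero, zero_add, one_mul]
      exact Nat.one_le_pow _ _ (by omega)
  | succ k ih =>
    intro s h1 hk
    obtain ⟨t₁, s₁, e₁, a₁, i₁, k₁, o₁, r₁, l₁⟩ := hc s h1
    obtain ⟨t₂, s₂, e₂, a₂, r₂, l₂⟩ := ih s₁ o₁ (by omega)
    have hctx : ∀ i, s₁.ctxAt R α i = s.ctxAt R α i :=
      Store.ctxAt_congr (r₁ _ (by omega)) (r₁ _ (by omega)) fun b => by simp [a₁, ha b]
    refine ⟨_, s₂, Exec.loop_true (by omega) e₁ e₂, ?_, fun x hx => by rw [r₂ x hx, r₁ x hx],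
      fun V hV h => ?_⟩
    · rw [a₂, a₁, Function.update_idem]
      congr 1
      funext i
      simp only [hctx, i₁, Function.update_self]
      rcases lt_trichotomy i (s.reg (R + 2)) with hi | rfl | hi
      · rw [if_neg (by omega), if_neg (by omega), Function.update_of_ne hi.ne]
      · rw [if_neg (by omega), if_pos (by omega), Function.update_self]
      · rw [Function.update_of_ne hi.ne']
        exact if_congr (by omega) rfl rfl
    · have hle : (s.ctxAt R α (s.reg (R + 2))).Le V := by
        refine ⟨fun i => ?_, h.inp⟩
        have h2 : s.reg (R + 2) + (k + 1) ≤ V := h.var 2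
        fin_cases i
        · exact h.var 0
        · exact h.var 1
        · show s.reg (R + 2) ≤ V
          omega
      have hkV : s.reg (R + 3) ≤ V := by
        have h2 : s.reg (R + 2) + (k + 1) ≤ V := h.var 2
        omega
      have h3 := l₁ V hV hle hkV
      have h4 := l₂ V hV (by rw [hctx, i₁, add_assoc, add_comm 1 k]; exact h)
      have h5 := pow_add_pow_le hV c 2
      have h6 := size_le_self (s.reg (R + 3))
      have : V * 2 ≤ V ^ 2 := by nlinarith
      have : (k + 1 + 1) * V ^ (c + 2 + 1) = V ^ (c + 2 + 1) + (k + 1) * V ^ (c + 2 + 1) := by ring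
      omega

theorem exec_fill (R : ℕ) {α : Bool → ℕ} {a : ℕ} (ha : ∀ b, α b ≠ a) (eb ev : Expr) :
    ∃ c : ℕ, ∀ s : Store,
      ∃ t s', Exec (fill R α a eb ev) s t s' ∧
        s'.arr = Function.update s.arr a (fun i =>
          if i < eb.eval (s.ctxAt R α 0) then ev.eval (s.ctxAt R α i) else s.arr a i) ∧
        (∀ x < R + 2, s'.reg x = s.reg x) ∧
        ∀ V, 2 ≤ V → (s.ctxAt R α 0).Le V → t ≤ V ^ c := by
  obtain ⟨c₁, h₁⟩ := eb.exec_compile R α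
  obtain ⟨d, hd⟩ := eb.exists_eval_le
  obtain ⟨c₂, h₂⟩ := exec_fill_loop R ha ev
  refine ⟨c₁ + ((d + 3 + 1) + ((d + 1) * (1 + c₂) + 0 + 1) + 1) + 1, fun s => ?_⟩
  obtain ⟨t₁, s₁, e₁, a₁, v₁, r₁, l₁⟩ := h₁ (R + 5) (s.setReg (R + 2) 0) (by omega)
  have hctx₁ : (s.setReg (R + 2) 0).ctx R α = s.ctxAt R α 0 := by
    rw [Store.ctx_eq_ctxAt]
    simp [Store.ctxAt, Store.setReg]
  rw [hctx₁] at v₁ l₁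
  have z₁ : s₁.reg (R + 2) = 0 := by simp [r₁, Store.setReg]
  set s₂ := (s₁.setReg (R + 3) (Op.add.eval (s₁.reg (R + 5)) (s₁.reg (R + 2)))).setReg (R + 4) 1
    with hs₂
  obtain ⟨t₃, s₃, e₃, a₃, r₃, l₃⟩ := h₂ (eb.eval (s.ctxAt R α 0)) s₂ (by simp [hs₂, Store.setReg])
    (by simp [hs₂, Store.setReg, Op.eval, v₁, z₁])
  have z₂ : s₂.reg (R + 2) = 0 := by simp [hs₂, Store.setReg, z₁]
  have hr₂ : ∀ x < R + 2, s₂.reg x = s.reg x := fun x hx => by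
    simp [hs₂, Store.setReg, hx.ne, r₁ x (by omega), show x ≠ R + 3 by omega,
      show x ≠ R + 4 by omega]
  have ha₂ : s₂.arr = s.arr := a₁
  have hctx₂ : ∀ i, s₂.ctxAt R α i = s.ctxAt R α i :=
    Store.ctxAt_congr (hr₂ _ (by omega)) (hr₂ _ (by omega)) fun b => by rw [ha₂]
  refine ⟨_, s₃, (Exec.const (R + 2) 0 s).seq (e₁.seq
    ((Exec.arith .add (R + 3) (R + 5) (R + 2) s₁).seq ((Exec.const (R + 4) 1 _).seq e₃))), ?_,
    fun x hx => by rw [r₃ x hx, hr₂ x hx], fun V hV h => ?_⟩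
  · rw [a₃, z₂, ha₂]
    simp [hctx₂]
  · rw [z₂, hctx₂] at l₃
    have hb := hd _ V hV h
    have hV1 : V ≤ V ^ (d + 1) := by
      calc V = V ^ 1 := (pow_one V).symm
        _ ≤ _ := Nat.pow_le_pow_right (by omega) (by omega)
    have hV2 : V ^ d + 1 ≤ V ^ (d + 1) := by
      have := pow_add_pow_le hV d 0
      simpa using this
    -- The loop index can reach the value of `eb`, which is bounded only by `V ^ d`, so the loop is
    -- analyzed with a larger bound on all numbers.
    have h3 := l₃ (V ^ (d + 1)) (by omega) (by
      refine ⟨fun i => ?_, fun b i => (h.inp b i).trans hV1⟩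
      fin_cases i
      · exact (h.var 0).trans hV1
      · exact (h.var 1).trans hV1
      · show 0 + eb.eval (s.ctxAt R α 0) ≤ V ^ (d + 1)
        omega)
    have h4 : (eb.eval (s.ctxAt R α 0) + 1) * (V ^ (d + 1)) ^ c₂ ≤ V ^ ((d + 1) * (1 + c₂)) := by
      calc _ ≤ V ^ (d + 1) * (V ^ (d + 1)) ^ c₂ := by gcongr; omega
        _ = _ := by rw [← pow_mul, ← pow_add]; congr 1; ring
    have h5 := pow_add_pow_le hV ((d + 1) * (1 + c₂)) 0
    have h6 := pow_add_pow_le hV d 3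
    have h7 := pow_add_pow_le hV (d + 3 + 1) ((d + 1) * (1 + c₂) + 0 + 1)
    have h8 := pow_add_pow_le hV c₁ ((d + 3 + 1) + ((d + 1) * (1 + c₂) + 0 + 1) + 1)
    have h9 := l₁ V hV h
    have h10 := size_le_self (eb.eval (s.ctxAt R α 0))
    have h11 : 8 ≤ V ^ 3 := Nat.pow_le_pow_left hV 3
    have h12 : Nat.size 1 = 1 := by simp
    rw [v₁, z₁, Nat.size_zero, h12]
    omega

end RAM

namespace RAM

/-! ### Definable functions and predicates -/

/-- The function is the value of an expression. -/
def DefFun (F : Ctx → ℕ) : Prop := ∃ e : Expr, ∀ Γ, e.eval Γ = F Γ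

/-- The predicate says that the value of an expression is not zero. -/
def DefPred (p : Ctx → Prop) : Prop := ∃ e : Expr, ∀ Γ, e.eval Γ ≠ 0 ↔ p Γ

namespace DefFun

variable {F G : Ctx → ℕ}

theorem var (i : Fin 3) : DefFun fun Γ => Γ.var i := ⟨.var i, fun _ => rfl⟩

theorem const (k : ℕ) : DefFun fun _ => k := ⟨.const k, fun _ => rfl⟩

theorem op (o : Op) (hF : DefFun F) (hG : DefFun G) : DefFun fun Γ => o.eval (F Γ) (G Γ) := by
  obtain ⟨e, he⟩ := hF
  obtain ⟨f, hf⟩ := hG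
  exact ⟨.op o e f, fun Γ => by simp [Expr.eval, he, hf]⟩

theorem input (b : Bool) (hF : DefFun F) : DefFun fun Γ => Γ.inp b (F Γ) := by
  obtain ⟨e, he⟩ := hF
  exact ⟨.input b e, fun Γ => by simp [Expr.eval, he]⟩

theorem add (hF : DefFun F) (hG : DefFun G) : DefFun fun Γ => F Γ + G Γ := hF.op .add hG

theorem sub (hF : DefFun F) (hG : DefFun G) : DefFun fun Γ => F Γ - G Γ := hF.op .sub hG

theorem mul (hF : DefFun F) (hG : DefFun G) : DefFun fun Γ => F Γ * G Γ := hF.op .mul hG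

theorem div (hF : DefFun F) (hG : DefFun G) : DefFun fun Γ => F Γ / G Γ := hF.op .div hG

theorem mod (hF : DefFun F) (hG : DefFun G) : DefFun fun Γ => F Γ % G Γ := by
  have : (fun Γ => F Γ % G Γ) = fun Γ => F Γ - G Γ * (F Γ / G Γ) := by
    funext Γ
    have := Nat.div_add_mod (F Γ) (G Γ)
    omega
  rw [this]
  exact hF.sub (hG.mul (hF.div hG))

end DefFun

namespace DefPred

variable {F G : Ctx → ℕ} {p p' : Ctx → Prop}

theorem congr (h : DefPred p) (hp : ∀ Γ, p' Γ ↔ p Γ) : DefPred p' := by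
  obtain ⟨e, he⟩ := h
  exact ⟨e, fun Γ => (he Γ).trans (hp Γ).symm⟩

theorem ne_zero (hF : DefFun F) : DefPred fun Γ => F Γ ≠ 0 := by
  obtain ⟨e, he⟩ := hF
  exact ⟨e, fun Γ => by rw [he]⟩

theorem lt (hF : DefFun F) (hG : DefFun G) : DefPred fun Γ => F Γ < G Γ :=
  (ne_zero (hG.sub hF)).congr fun Γ => by omega

theorem le (hF : DefFun F) (hG : DefFun G) : DefPred fun Γ => F Γ ≤ G Γ :=
  (lt hF (hG.add (.const 1))).congr fun Γ => by omega

theorem not (hp : DefPred p) : DefPred fun Γ => ¬ p Γ := by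
  obtain ⟨e, he⟩ := hp
  refine (ne_zero (F := fun Γ => 1 - e.eval Γ) ((DefFun.const 1).sub ⟨e, fun _ => rfl⟩)).congr
    fun Γ => ?_
  rw [← he]
  omega

theorem and (hp : DefPred p) (hp' : DefPred p') : DefPred fun Γ => p Γ ∧ p' Γ := by
  obtain ⟨e, he⟩ := hp
  obtain ⟨f, hf⟩ := hp'
  refine (ne_zero (F := fun Γ => e.eval Γ * f.eval Γ)
    (DefFun.mul ⟨e, fun _ => rfl⟩ ⟨f, fun _ => rfl⟩)).congr fun Γ => ?_
  rw [← he, ← hf, mul_ne_zero_iff]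

theorem or (hp : DefPred p) (hp' : DefPred p') : DefPred fun Γ => p Γ ∨ p' Γ :=
  (hp.not.and hp'.not).not.congr fun Γ => by tauto

theorem eq (hF : DefFun F) (hG : DefFun G) : DefPred fun Γ => F Γ = G Γ :=
  ((le hF hG).and (le hG hF)).congr fun Γ => by omega

/-- A condition that does not depend on the context is decided once, when the expression is chosen;
no computability is needed. -/
theorem const (q : Prop) : DefPred fun _ => q := by
  by_cases h : q
  · exact ⟨.const 1, fun _ => by simp [Expr.eval, h]⟩
  · exact ⟨.const 0, fun _ => by simp [Expr.eval, h]⟩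

theorem exists_finset {ι : Type*} (s : Finset ι) {P : ι → Ctx → Prop} (h : ∀ i, DefPred (P i)) :
    DefPred fun Γ => ∃ i ∈ s, P i Γ := by
  classical
  induction s using Finset.induction_on with
  | empty => exact (const False).congr fun Γ => by simp
  | insert i s _ ih => exact ((h i).or ih).congr fun Γ => by simp

theorem exists_finite {ι : Type*} [Finite ι] {P : ι → Ctx → Prop} (h : ∀ i, DefPred (P i)) :
    DefPred fun Γ => ∃ i, P i Γ := by
  have := Fintype.ofFinite ι
  exact (exists_finset Finset.univ h).congr fun Γ => by simp

open scoped Classical in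
theorem ite (hp : DefPred p) : DefFun fun Γ => if p Γ then 1 else 0 := by
  obtain ⟨e, he⟩ := hp
  -- With truncated subtraction, `1 - (1 - e)` is 0 for `e = 0` and 1 otherwise.
  refine ⟨.op .sub (.const 1) (.op .sub (.const 1) e), fun Γ => ?_⟩
  have := he Γ
  simp only [Expr.eval, Op.eval]
  split_ifs with h
  · have := this.2 h
    omega
  · have : e.eval Γ = 0 := by tauto
    omega

end DefPred

/-! ### Programs that translate instances -/

/-- The context given by the numbers `n`, `m`, `i` and the input arrays `inp`. -/
def Ctx.of (n m : ℕ) (inp : Bool → ℕ → ℕ) (i : ℕ) : Ctx := ⟨![n, m, i], inp⟩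

/-- The program that copies the input to registers and arrays with names from `R` on, and writes the
output given by the expressions to the registers and arrays `0` and `1`. -/
def translate (R : ℕ) (eN eX eA eB : Expr) : Prog :=
  let α : Bool → ℕ := fun b => if b then 0 else 1
  let α' : Bool → ℕ := fun b => if b then R else R + 1
  let len : Expr := .op .mul (.var 1) (.var 0)
  .seq (.arith .add R 0 R) <| .seq (.arith .add (R + 1) 1 (R + 1)) <|
  .seq (fill R α R len (.input true (.var 2))) <|
  .seq (fill R α (R + 1) len (.input false (.var 2))) <|
  .seq (fill R α' 0 (.op .mul eN eN) eA) <|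
  .seq (fill R α' 1 (.op .mul eX eN) eB) <|
  .seq (.const (R + 2) 0) <|
  .seq (eN.compile R α' (R + 5)) <| .seq (.arith .add 0 (R + 5) (R + 2)) <|
  .seq (eX.compile R α' (R + 5)) (.arith .add 1 (R + 5) (R + 2))

/-- The output goes to the places that hold the input, so the input is first copied to names from
`R` on and only read from there. Output cells outside the written range keep their old input values;
the caller has to see that these are 0. -/
theorem exec_translate {R : ℕ} (hR : 2 ≤ R) (eN eX eA eB : Expr) :
    ∃ c : ℕ, ∀ (n m : ℕ) (inp : Bool → ℕ → ℕ) (s : Store),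
      s.reg 0 = n → s.reg 1 = m → (∀ x, 2 ≤ x → s.reg x = 0) →
      s.arr 0 = inp true → s.arr 1 = inp false → (∀ a, 2 ≤ a → s.arr a = fun _ => 0) →
      (∀ b i, inp b i ≤ 1) → (∀ b i, m * n ≤ i → inp b i = 0) →
      ∃ t s', Exec (translate R eN eX eA eB) s t s' ∧
        s'.reg 0 = eN.eval (.of n m inp 0) ∧ s'.reg 1 = eX.eval (.of n m inp 0) ∧
        (∀ x, 2 ≤ x → x < R → s'.reg x = 0) ∧
        s'.arr 0 = (fun i => if i < eN.eval (.of n m inp 0) * eN.eval (.of n m inp 0)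
          then eA.eval (.of n m inp i) else inp true i) ∧
        s'.arr 1 = (fun i => if i < eX.eval (.of n m inp 0) * eN.eval (.of n m inp 0)
          then eB.eval (.of n m inp i) else inp false i) ∧
        (∀ a, 2 ≤ a → a < R → s'.arr a = fun _ => 0) ∧
        t ≤ (n + m + 2) ^ c := by
  set α : Bool → ℕ := fun b => if b then 0 else 1 with hα
  set α' : Bool → ℕ := fun b => if b then R else R + 1 with hα'
  obtain ⟨c₁, H₁⟩ := exec_fill R (α := α) (a := R) (by rintro (_ | _) <;> grind)
    (.op .mul (.var 1) (.var 0)) (.input true (.var 2))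
  obtain ⟨c₂, H₂⟩ := exec_fill R (α := α) (a := R + 1) (by rintro (_ | _) <;> grind)
    (.op .mul (.var 1) (.var 0)) (.input false (.var 2))
  obtain ⟨c₃, H₃⟩ := exec_fill R (α := α') (a := 0) (by rintro (_ | _) <;> grind)
    (.op .mul eN eN) eA
  obtain ⟨c₄, H₄⟩ := exec_fill R (α := α') (a := 1) (by rintro (_ | _) <;> grind)
    (.op .mul eX eN) eB
  obtain ⟨c₅, H₅⟩ := eN.exec_compile R α'
  obtain ⟨c₆, H₆⟩ := eX.exec_compile R α'
  obtain ⟨c₇, H₇⟩ := eN.exists_eval_le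
  obtain ⟨c₈, H₈⟩ := eX.exists_eval_le
  refine ⟨(c₁ + c₂ + 1) + (c₃ + c₄ + 1) + 1 + ((c₅ + c₆ + 1) + (c₇ + c₈ + 1) + 1) + 1 + 5 + 1,
    fun n m inp s hs₀ hs₁ hsr ha₀ ha₁ hsa hle hz => ?_⟩
  set N := eN.eval (.of n m inp 0) with hN
  set X := eX.eval (.of n m inp 0) with hX
  set s₁ := (s.setReg R (Op.add.eval (s.reg 0) (s.reg R))).setReg (R + 1)
    (Op.add.eval ((s.setReg R (Op.add.eval (s.reg 0) (s.reg R))).reg 1)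
      ((s.setReg R (Op.add.eval (s.reg 0) (s.reg R))).reg (R + 1))) with hs₁'
  have r₁0 : s₁.reg R = n := by
    simp [hs₁', Store.setReg, Op.eval, hs₀, hsr R hR]
  have r₁1 : s₁.reg (R + 1) = m := by
    simp [hs₁', Store.setReg, Op.eval, hs₁, hsr (R + 1) (by omega), show 1 ≠ R by omega]
  have r₁x : ∀ x < R, s₁.reg x = s.reg x := fun x hx => by
    simp [hs₁', Store.setReg, hx.ne, show x ≠ R + 1 by omega]
  have a₁ : s₁.arr = s.arr := rfl
  have ctxα : ∀ (r : Store), r.reg R = n → r.reg (R + 1) = m → r.arr 0 = inp true →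
      r.arr 1 = inp false → ∀ i, r.ctxAt R α i = .of n m inp i := by
    intro r h0 h1 h2 h3 i
    simp only [Store.ctxAt, Ctx.of, h0, h1, Ctx.mk.injEq, true_and]
    funext b
    cases b <;> simp [hα, h2, h3]
  have ctxα' : ∀ (r : Store), r.reg R = n → r.reg (R + 1) = m → r.arr R = inp true →
      r.arr (R + 1) = inp false → ∀ i, r.ctxAt R α' i = .of n m inp i := by
    intro r h0 h1 h2 h3 i
    simp only [Store.ctxAt, Ctx.of, h0, h1, Ctx.mk.injEq, true_and]
    funext b
    cases b <;> simp [hα', h2, h3]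
  have hLe : (Ctx.of n m inp 0).Le (n + m + 2) := by
    refine ⟨fun i => ?_, fun b i => (hle b i).trans (by omega)⟩
    fin_cases i <;> simp [Ctx.of] <;> omega
  -- The input arrays vanish from cell `m * n` on, so copying this many cells copies them entirely.
  have copy : ∀ b : Bool, (fun i => if i < m * n then inp b i else 0) = inp b := by
    intro b
    funext i
    split_ifs with h
    · rfl
    · exact (hz b i (by omega)).symm
  obtain ⟨t₂, s₂, e₂, a₂, r₂, l₂⟩ := H₁ s₁
  have C₁ := ctxα s₁ r₁0 r₁1 (by rw [a₁, ha₀]) (by rw [a₁, ha₁])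
  simp only [C₁] at a₂ l₂
  have a₂' : s₂.arr = Function.update s.arr R (inp true) := by
    rw [a₂, a₁, hsa R hR, ← copy true]
    rfl
  obtain ⟨t₃, s₃, e₃, a₃, r₃, l₃⟩ := H₂ s₂
  have r₂0 : s₂.reg R = n := by rw [r₂ _ (by omega), r₁0]
  have r₂1 : s₂.reg (R + 1) = m := by rw [r₂ _ (by omega), r₁1]
  have C₂ := ctxα s₂ r₂0 r₂1 (by simp [a₂', ha₀, show 0 ≠ R by omega])
    (by simp [a₂', ha₁, show 1 ≠ R by omega])
  simp only [C₂] at a₃ l₃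
  have a₃' : s₃.arr = Function.update (Function.update s.arr R (inp true)) (R + 1) (inp false) := by
    rw [a₃, a₂', Function.update_of_ne (by omega), hsa (R + 1) (by omega), ← copy false]
    rfl
  obtain ⟨t₄, s₄, e₄, a₄, r₄, l₄⟩ := H₃ s₃
  have r₃0 : s₃.reg R = n := by rw [r₃ _ (by omega), r₂0]
  have r₃1 : s₃.reg (R + 1) = m := by rw [r₃ _ (by omega), r₂1]
  have C₃ := ctxα' s₃ r₃0 r₃1 (by simp [a₃']) (by simp [a₃'])
  simp only [C₃] at a₄ l₄
  obtain ⟨t₅, s₅, e₅, a₅, r₅, l₅⟩ := H₄ s₄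
  have r₄0 : s₄.reg R = n := by rw [r₄ _ (by omega), r₃0]
  have r₄1 : s₄.reg (R + 1) = m := by rw [r₄ _ (by omega), r₃1]
  have C₄ := ctxα' s₄ r₄0 r₄1 (by simp [a₄, a₃', show R ≠ 0 by omega]) (by simp [a₄, a₃'])
  simp only [C₄] at a₅ l₅
  have r₅0 : s₅.reg R = n := by rw [r₅ _ (by omega), r₄0]
  have r₅1 : s₅.reg (R + 1) = m := by rw [r₅ _ (by omega), r₄1]
  have C₅ := ctxα' s₅ r₅0 r₅1 (by simp [a₅, a₄, a₃', show R ≠ 0 by omega, show R ≠ 1 by omega])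
    (by simp [a₅, a₄, a₃', show R ≠ 0 by omega])
  obtain ⟨t₆, s₆, e₆, a₆, v₆, r₆, l₆⟩ := H₅ (R + 5) (s₅.setReg (R + 2) 0) (by omega)
  have C₅' : (s₅.setReg (R + 2) 0).ctx R α' = .of n m inp 0 := by
    rw [← C₅, Store.ctx_eq_ctxAt]
    simp [Store.ctxAt, Store.setReg]
  rw [C₅'] at v₆ l₆
  set s₇ := s₆.setReg 0 (Op.add.eval (s₆.reg (R + 5)) (s₆.reg (R + 2))) with hs₇
  have z₆ : s₆.reg (R + 2) = 0 := by simp [r₆, Store.setReg]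
  have z₇ : s₇.reg (R + 2) = 0 := by simp [hs₇, Store.setReg, z₆]
  have C₇ : s₇.ctx R α' = .of n m inp 0 := by
    rw [← C₅', Store.ctx_eq_ctxAt, Store.ctx_eq_ctxAt, z₇]
    have : (s₅.setReg (R + 2) 0).reg (R + 2) = 0 := by simp [Store.setReg]
    rw [this]
    apply Store.ctxAt_congr
    · simp [hs₇, Store.setReg, r₆, show R ≠ 0 by omega]
    · simp [hs₇, Store.setReg, r₆]
    · intro b
      simp [hs₇, Store.setReg, a₆]
  obtain ⟨t₈, s₈, e₈, a₈, v₈, r₈, l₈⟩ := H₆ (R + 5) s₇ (by omega)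
  rw [C₇] at v₈ l₈
  have z₈ : s₈.reg (R + 2) = 0 := by rw [r₈ _ (by omega), z₇]
  have arr₈ : s₈.arr = s₅.arr := by
    rw [a₈]
    exact a₆
  refine ⟨_, _, (Exec.arith .add R 0 R s).seq ((Exec.arith .add (R + 1) 1 (R + 1) _).seq
    (e₂.seq (e₃.seq (e₄.seq (e₅.seq ((Exec.const (R + 2) 0 s₅).seq (e₆.seq
    ((Exec.arith .add 0 (R + 5) (R + 2) s₆).seq (e₈.seq (.arith .add 1 (R + 5) (R + 2) s₈)))))))))),
    ?_, ?_, fun x hx hxR => ?_, ?_, ?_, fun a ha haR => ?_, ?_⟩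
  · simp [Store.setReg, r₈, hs₇, v₆, z₆, Op.eval, hN]
  · simp [Store.setReg, v₈, z₈, Op.eval, hX]
  · simp [Store.setReg, r₈ x (by omega), hs₇, r₆ x (by omega), r₅ x (by omega), r₄ x (by omega),
      r₃ x (by omega), r₂ x (by omega), r₁x x hxR, hsr x hx, show x ≠ 0 by omega,
      show x ≠ 1 by omega, show x ≠ R + 2 by omega]
  · show s₈.arr 0 = _
    simp [arr₈, a₅, a₄, a₃', ha₀, Expr.eval, Op.eval, hN, show (0 : ℕ) ≠ R by omega]
  · show s₈.arr 1 = _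
    simp [arr₈, a₅, a₄, a₃', ha₁, Expr.eval, Op.eval, hN, hX, Function.update_apply,
      show (1 : ℕ) ≠ R by omega, show R ≠ 0 by omega]
  · show s₈.arr a = _
    simp [arr₈, a₅, a₄, a₃', hsa a ha, show a ≠ R by omega, show a ≠ 0 by omega,
      show a ≠ 1 by omega, show a ≠ R + 1 by omega]
  · have hV : 2 ≤ n + m + 2 := by omega
    have k₂ := l₂ _ hV hLe
    have k₃ := l₃ _ hV hLe
    have k₄ := l₄ _ hV hLe
    have k₅ := l₅ _ hV hLe
    have k₆ := l₆ _ hV hLe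
    have k₈ := l₈ _ hV hLe
    have k₉ := (size_le_self _).trans (H₇ _ _ hV hLe)
    have k₁₀ := (size_le_self _).trans (H₈ _ _ hV hLe)
    have p₁ := pow_add_pow_le hV c₁ c₂
    have p₂ := pow_add_pow_le hV c₃ c₄
    have p₃ := pow_add_pow_le hV c₅ c₆
    have p₄ := pow_add_pow_le hV c₇ c₈
    have p₅ := pow_add_pow_le hV (c₁ + c₂ + 1) (c₃ + c₄ + 1)
    have p₆ := pow_add_pow_le hV (c₅ + c₆ + 1) (c₇ + c₈ + 1)
    have p₇ := pow_add_pow_le hV ((c₁ + c₂ + 1) + (c₃ + c₄ + 1) + 1)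
      ((c₅ + c₆ + 1) + (c₇ + c₈ + 1) + 1)
    have p₈ := pow_add_pow_le hV ((c₁ + c₂ + 1) + (c₃ + c₄ + 1) + 1 +
      ((c₅ + c₆ + 1) + (c₇ + c₈ + 1) + 1) + 1) 5
    have p₉ : (n + m + 2) * 16 ≤ (n + m + 2) ^ 5 := by
      have := Nat.pow_le_pow_left hV 4
      calc (n + m + 2) * 16 ≤ (n + m + 2) * (n + m + 2) ^ 4 := by gcongr
        _ = _ := by ring
    have q₁ := size_le_self n
    have q₂ := size_le_self m
    have w₁ : (s.setReg R (Op.add.eval (s.reg 0) (s.reg R))).reg 1 = m := by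
      simp [Store.setReg, hs₁, show 1 ≠ R by omega]
    have w₂ : (s.setReg R (Op.add.eval (s.reg 0) (s.reg R))).reg (R + 1) = 0 := by
      simp [Store.setReg, hsr (R + 1) (by omega)]
    rw [w₁, w₂, hs₀, hsr R hR, v₆, v₈, z₆, z₈, Nat.size_zero]
    omega

end RAM

/-! ### The graph of a layout -/

/-- The gadget vertices of a block. -/
inductive Node (q γ : ℕ) where
  /-- the vertices whose colors encode the assignment -/
  | tape (i : Fin γ)
  /-- the cliques that make tape vertices of different blocks equal -/
  | link (i : Fin γ) (e : Fin (q - 1))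
  /-- the copies of tape vertices within a block -/
  | copy (i : Fin γ)
  /-- tells whether the current clause is satisfied before the block -/
  | flag
  /-- has color 2 if the current clause becomes satisfied in the block -/
  | switch
  /-- the vertices that transmit the state of the switch -/
  | wire (k : Fin (3 * (γ * q)))
  /-- tests whether a tape vertex has a color other than `c` -/
  | probe (i : Fin γ) (c : Fin q)
  /-- the center of a star -/
  | hub
  /-- the leaves of a star -/
  | leaf (e : Fin (2 * q - 1))
deriving DecidableEq, Fintype

/-- A vertex of a block: a gadget vertex, or one of the palette vertices that go with it. -/
abbrev Site (q γ : ℕ) := Node q γ × Option (Fin q)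

/-- The data that determine the graph. -/
structure Layout (γ : ℕ) where
  /-- the distance of blocks with equal tape vertices -/
  step : ℕ
  /-- the block is the first one of a clause -/
  first : ℕ → Prop
  /-- the block is the last one of a clause -/
  last : ℕ → Prop
  /-- the clause may become satisfied in the block -/
  active : ℕ → Prop
  /-- the colors of the tape for which the clause may become satisfied in the block -/
  word : ℕ → Fin γ → ℕ

/-- The colors used on the wires. -/
def tone (k : ℕ) : ℕ := (k + 2) % 3

theorem tone_succ_ne (k : ℕ) : tone (k + 1) ≠ tone k := by
  unfold tone
  omega

theorem tone_lt (k : ℕ) : tone k < 3 := by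
  unfold tone
  omega

/-- The position on the wire where the probe for digit `i` and color `c` is attached. -/
def slot (q i c : ℕ) : ℕ := 3 * (i * q + c) + if c = 0 then 2 else if c = 1 then 0 else 1

theorem slot_lt {q γ : ℕ} (i : Fin γ) (c : Fin q) : slot q i c < 3 * (γ * q) := by
  have h : (i.val + 1) * q ≤ γ * q := Nat.mul_le_mul_right q i.isLt
  have h' : (i.val + 1) * q = i * q + q := by ring
  unfold slot
  split_ifs <;> omega

theorem slot_injective {q γ : ℕ} {i i' : Fin γ} {c c' : Fin q} (h : slot q i c = slot q i' c') :
    i = i' ∧ c = c' := by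
  have h1 : i.val * q + c = i' * q + c' := by
    unfold slot at h
    split_ifs at h <;> omega
  have hq : 0 < q := c.pos
  have h2 : i.val = i' := by
    have := congrArg (· / q) h1
    simpa [mul_comm _ q, Nat.mul_add_div hq, Nat.div_eq_of_lt c.isLt, Nat.div_eq_of_lt c'.isLt]
      using this
  refine ⟨Fin.ext h2, Fin.ext ?_⟩
  rw [h2] at h1
  omega

/-- The wire colors have period 3 in the position, and `slot` picks the residue for which the two
tones around it both differ from `c`. Hence the list of a probe really has two colors, and the probe
may take color `c` whichever of its two colors the wire has. -/
theorem tone_slot_ne (q i c : ℕ) : tone (slot q i c) ≠ c := by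
  unfold tone slot
  split_ifs <;> omega

theorem tone_slot_succ_ne (q i c : ℕ) : tone (slot q i c + 1) ≠ c := by
  unfold tone slot
  split_ifs <;> omega

namespace Layout

variable {q γ : ℕ} (L : Layout γ)

/-- The color `c` is on the list of the gadget vertex `a` of block `x`. -/
def Allowed (x : ℕ) : Node q γ → ℕ → Prop
  | .flag, c => c = 0 ∨ c = 1 ∧ ¬ L.first x
  | .switch, c => c = 0 ∨ c = 1 ∧ ¬ L.last x ∨ c = 2 ∧ L.active x
  | .wire k, c => c = tone k ∨ c = tone (k + 1)
  | .probe i c', c => c = c' ∨ c = tone (slot q i c' + 1)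
  | _, _ => True

/-- The edges between gadget vertices, with one orientation. -/
inductive Edge : ℕ → Node q γ → ℕ → Node q γ → Prop
  | tape_link (x i e) : Edge x (.tape i) x (.link i e)
  | link_tape (x i e) : Edge x (.link i e) (x + L.step) (.tape i)
  | link_link (x i e e') : e ≠ e' → Edge x (.link i e) x (.link i e')
  | link_copy (x i e) : Edge x (.link i e) x (.copy i)
  | flag_switch (x) : Edge x .flag x .switch
  | switch_flag (x) : ¬ L.last x → Edge x .switch (x + 1) .flag
  | switch_wire (x k) : k.val = 0 → Edge x .switch x (.wire k)
  | wire_wire (x k k') : k'.val = k.val + 1 → Edge x (.wire k) x (.wire k')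
  | wire_probe (x k) (i : Fin γ) (c : Fin q) : k.val = slot q i c → Edge x (.wire k) x (.probe i c)
  | probe_copy (x) (i : Fin γ) (c : Fin q) : c.val ≠ L.word x i → Edge x (.probe i c) x (.copy i)
  | hub_leaf (x e) : Edge x .hub x (.leaf e)

/-- The position of the palette that goes with the gadget vertex `a` of block `x`. -/
noncomputable def pos (x : ℕ) (a : Node q γ) : ℕ :=
  x * Fintype.card (Node q γ) + Fintype.equivFin (Node q γ) a

/-- The edges of the graph, with one orientation. -/
inductive Arc : ℕ → Site q γ → ℕ → Site q γ → Prop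
  | edge {x a y b} : L.Edge x a y b → Arc x (a, none) y (b, none)
  | ban {x a c} : ¬ L.Allowed x a (Fin.val c) → Arc x (a, none) x (a, some c)
  | clique {x a c c'} : pos x a = 0 → c ≠ c' → Arc x (a, some c) x (a, some c')
  | chain {x a y b c c'} : pos y b = pos x a + 1 → c ≠ c' → Arc x (a, some c) y (b, some c')

/-! ### Palette positions and the shape of arcs -/

theorem card_node_pos : 0 < Fintype.card (Node q γ) := Fintype.card_pos_iff.2 ⟨.hub⟩

/-- The palette at position `p`. -/
noncomputable def unpos (p : ℕ) : ℕ × Node q γ :=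
  (p / Fintype.card (Node q γ),
    (Fintype.equivFin (Node q γ)).symm ⟨p % Fintype.card (Node q γ), Nat.mod_lt _ card_node_pos⟩)

theorem unpos_pos (x : ℕ) (a : Node q γ) : unpos (pos x a) = (x, a) := by
  have h := (Fintype.equivFin (Node q γ) a).isLt
  refine Prod.ext ?_ ?_
  · simp only [unpos, pos]
    rw [mul_comm, Nat.mul_add_div card_node_pos, Nat.div_eq_of_lt h, add_zero]
  · simp only [unpos, pos]
    rw [Equiv.symm_apply_eq, Fin.ext_iff]
    simp only
    rw [mul_comm, Nat.mul_add_mod, Nat.mod_eq_of_lt h]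

theorem pos_unpos (p : ℕ) :
    pos (unpos (q := q) (γ := γ) p).1 (unpos (q := q) (γ := γ) p).2 = p := by
  simp only [unpos, pos, Equiv.apply_symm_apply]
  exact Nat.div_add_mod' _ _

theorem pos_lt {X x : ℕ} (hx : x < X) (a : Node q γ) :
    pos x a < X * Fintype.card (Node q γ) := by
  have h := (Fintype.equivFin (Node q γ) a).isLt
  calc pos x a < x * Fintype.card (Node q γ) + Fintype.card (Node q γ) := by unfold pos; omega
    _ = (x + 1) * Fintype.card (Node q γ) := by ring
    _ ≤ _ := Nat.mul_le_mul_right _ hx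

variable {L}

theorem Edge.ne {x y : ℕ} {a b : Node q γ} (h : L.Edge x a y b) : (x, a) ≠ (y, b) := by
  cases h <;> simp [Fin.ext_iff]
  · exact Fin.val_ne_of_ne ‹_›
  · omega

theorem arc_none_none_iff {x y : ℕ} {a b : Node q γ} :
    L.Arc x (a, none) y (b, none) ↔ L.Edge x a y b :=
  ⟨fun h => by cases h; assumption, .edge⟩

theorem arc_none_some_iff {x y : ℕ} {a b : Node q γ} {c : Fin q} :
    L.Arc x (a, none) y (b, some c) ↔ x = y ∧ a = b ∧ ¬ L.Allowed x a c := by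
  refine ⟨fun h => by cases h; exact ⟨rfl, rfl, by assumption⟩, ?_⟩
  rintro ⟨rfl, rfl, h⟩
  exact .ban h

theorem not_arc_some_none {x y : ℕ} {a b : Node q γ} {c : Fin q} :
    ¬ L.Arc x (a, some c) y (b, none) := fun h => by cases h

theorem arc_some_some_iff {x y : ℕ} {a b : Node q γ} {c c' : Fin q} :
    L.Arc x (a, some c) y (b, some c') ↔
      c ≠ c' ∧ (pos y b = pos x a + 1 ∨ x = y ∧ a = b ∧ pos x a = 0) := by
  constructor
  · intro h
    cases h with
    | clique h hc => exact ⟨hc, Or.inr ⟨rfl, rfl, h⟩⟩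
    | chain h hc => exact ⟨hc, Or.inl h⟩
  · rintro ⟨hc, h | ⟨rfl, rfl, h⟩⟩
    · exact .chain h hc
    · exact .clique h hc

theorem Arc.ne {x y : ℕ} {t u : Site q γ} (h : L.Arc x t y u) : (x, t) ≠ (y, u) := by
  cases h with
  | edge h =>
    have := h.ne
    simp_all
  | ban h => simp
  | clique _ h => simp [h]
  | chain _ h => simp [h]

/-- The tape vertex `i` of a block, as a site. -/
def tapeSite (q : ℕ) {γ : ℕ} (i : Fin γ) : Site q γ := (.tape i, none)

/-- Palettes are ordered block by block, so consecutive ones lie at most one block apart. Only the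
arcs from a clique to the next tape vertex of the group reach further, which is why wide bags need
to hold only tape vertices. -/
theorem Arc.near {x y : ℕ} {t u : Site q γ} (h : L.Arc x t y u) :
    y = x ∨ y = x + 1 ∨ y = x + L.step ∧ ∃ i, u = tapeSite q i := by
  obtain ⟨a, _ | c⟩ := t <;> obtain ⟨b, _ | c'⟩ := u
  · rw [arc_none_none_iff] at h
    cases h <;> simp [tapeSite]
  · exact Or.inl (arc_none_some_iff.1 h).1.symm
  · exact absurd h not_arc_some_none
  · obtain ⟨-, h | ⟨rfl, -⟩⟩ := arc_some_some_iff.1 h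
    swap
    · exact Or.inl rfl
    have ha := (Fintype.equivFin (Node q γ) a).isLt
    have hb := (Fintype.equivFin (Node q γ) b).isLt
    unfold pos at h
    generalize (Fintype.equivFin (Node q γ) a).val = k at ha h
    generalize (Fintype.equivFin (Node q γ) b).val = l at hb h
    generalize Fintype.card (Node q γ) = B at ha hb h
    rcases lt_trichotomy y x with hlt | heq | hgt
    · exfalso
      have : (y + 1) * B ≤ x * B := Nat.mul_le_mul_right _ hlt
      have e : (y + 1) * B = y * B + B := by ring
      omega
    · exact Or.inl heq
    · right; left
      by_contra hne
      have : (x + 2) * B ≤ y * B := Nat.mul_le_mul_right _ (by omega)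
      have e : (x + 2) * B = x * B + B + B := by ring
      omega

/-! ### Colorings -/

variable (L)

/-- A list coloring of the gadget vertices of the first `X` blocks. -/
structure IsListColoring (X : ℕ) (f : ℕ → Node q γ → Fin q) : Prop where
  allowed : ∀ x < X, ∀ a, L.Allowed x a (f x a)
  proper : ∀ x < X, ∀ y < X, ∀ a b, L.Edge x a y b → f x a ≠ f y b

/-- A coloring of the first `X` blocks. -/
def IsColoring (X : ℕ) (f : ℕ → Site q γ → Fin q) : Prop :=
  ∀ x < X, ∀ y < X, ∀ t u, L.Arc x t y u → f x t ≠ f y u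

variable {L}

theorem IsListColoring.isColoring {X : ℕ} {f : ℕ → Node q γ → Fin q} (hf : L.IsListColoring X f) :
    L.IsColoring X fun x t => t.2.getD (f x t.1) := by
  intro x hx y hy t u h
  cases h with
  | edge h => exact hf.proper x hx y hy _ _ h
  | ban h =>
    rintro rfl
    exact h (hf.allowed x hx _)
  | clique _ h => exact h
  | chain _ h => exact h

/-- The first palette is a clique, hence its coloring is a bijection of the `q` colors. A vertex of
a later palette avoids all but one color of the preceding palette, so it repeats the color of its
counterpart. Renaming colors by the inverse bijection turns edges to palette vertices into lists. -/
theorem IsColoring.exists_isListColoring {X : ℕ} {f : ℕ → Site q γ → Fin q}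
    (hf : L.IsColoring X f) : ∃ g : ℕ → Node q γ → Fin q, L.IsListColoring X g := by
  rcases X.eq_zero_or_pos with rfl | hX
  · exact ⟨fun x a => f x (a, none), by simp, by simp⟩
  set π : ℕ → Fin q → Fin q := fun p c => f (unpos (q := q) (γ := γ) p).1 ((unpos p).2, some c)
    with hπ
  have hlt : ∀ p < X * Fintype.card (Node q γ), (unpos (q := q) (γ := γ) p).1 < X := fun p hp =>
    Nat.div_lt_of_lt_mul (by rwa [mul_comm] at hp)
  have h0 : Function.Injective (π 0) := by
    intro c c' h
    by_contra hne
    have h1 := hlt 0 (Nat.mul_pos hX card_node_pos)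
    exact hf _ h1 _ h1 _ _ (.clique (pos_unpos 0) hne) h
  have hpal : ∀ p < X * Fintype.card (Node q γ), π p = π 0 := by
    intro p
    induction p with
    | zero => intro _; rfl
    | succ p ih =>
      intro hp
      have ih := ih (by omega)
      funext c
      -- Every color occurs in palette 0, say at `c'`; if `c' ≠ c`, the arc from vertex `c'` of
      -- palette `p` is violated.
      obtain ⟨c', hc'⟩ := (Finite.injective_iff_surjective.1 h0) (π (p + 1) c)
      rw [← hc']
      congr 1
      by_contra hne
      refine hf _ (hlt p (by omega)) _ (hlt _ hp) _ _
        (.chain (a := (unpos p).2) (b := (unpos (p + 1)).2) ?_ hne) ((congrFun ih c').trans hc')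
      rw [pos_unpos, pos_unpos]
  have hpal' : ∀ x < X, ∀ a : Node q γ, ∀ c, f x (a, some c) = π 0 c := by
    intro x hx a c
    rw [← hpal _ (pos_lt hx a), hπ]
    simp only [unpos_pos]
  let e : Fin q ≃ Fin q := Equiv.ofBijective _ (Finite.injective_iff_bijective.1 h0)
  have he : ∀ c, π 0 c = e c := fun _ => rfl
  refine ⟨fun x a => e.symm (f x (a, none)), fun x hx a => ?_, fun x hx y hy a b h h' => ?_⟩
  · by_contra hne
    refine hf x hx x hx _ _ (.ban hne) ?_
    rw [hpal' x hx, he, Equiv.apply_symm_apply]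
  · exact hf x hx y hy _ _ (.edge h) (e.symm.injective h')

/-! ### Degrees -/

theorem encard_union_le_add {α : Type*} {s t : Set α} {m n : ℕ} (hs : s.encard ≤ m)
    (ht : t.encard ≤ n) : (s ∪ t).encard ≤ (m + n : ℕ) := by
  push_cast
  exact (Set.encard_union_le s t).trans (add_le_add hs ht)

theorem encard_image_le_card {α ι : Type*} [Fintype ι] (f : ι → α) (s : Finset ι) :
    (f '' s).encard ≤ s.card := by
  rw [← Set.encard_coe_eq_coe_finsetCard]
  exact Set.encard_image_le f _

theorem encard_range_le {α : Type*} {n : ℕ} (f : Fin n → α) : (Set.range f).encard ≤ n := by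
  simpa using encard_image_le_card f Finset.univ

variable (L)

/-- The adjacency of gadget vertices. -/
def gadgetNbrs (x : ℕ) (a : Node q γ) : Set (ℕ × Node q γ) :=
  {v | L.Edge x a v.1 v.2 ∨ L.Edge v.1 v.2 x a}

/-- The gadget vertex may have every color. -/
def _root_.Node.IsFree : Node q γ → Prop
  | .flag | .switch | .wire _ | .probe _ _ => False
  | _ => True

variable {L}

theorem exists_allowed (hq : 3 ≤ q) {a : Node q γ} (x : ℕ) (ha : ¬ a.IsFree) :
    ∃ c : Fin q, L.Allowed x a c := by
  cases a with
  | flag => exact ⟨⟨0, by omega⟩, Or.inl rfl⟩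
  | switch => exact ⟨⟨0, by omega⟩, Or.inl rfl⟩
  | wire k => exact ⟨⟨tone k, (tone_lt k).trans_le hq⟩, Or.inl rfl⟩
  | probe i c => exact ⟨c, Or.inl rfl⟩
  | _ => simp [Node.IsFree] at ha

/-- Vertices without a list have no palette edges. A tape vertex meets two cliques, which leaves no
room for the probes; these are attached to a copy, with at most `(q - 1) + q` neighbors. -/
theorem encard_gadgetNbrs_le_of_isFree (hq : 3 ≤ q) {a : Node q γ} (x : ℕ) (ha : a.IsFree) :
    (L.gadgetNbrs x a).encard ≤ (2 * q - 1 : ℕ) := by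
  cases a with
  | tape i =>
    refine (Set.encard_le_encard (t := Set.range (fun e => (x, .link i e)) ∪
      Set.range (fun e => (x - L.step, .link i e))) ?_).trans
      ((encard_union_le_add (encard_range_le _) (encard_range_le _)).trans
        (Nat.cast_le.2 (by omega)))
    rintro ⟨y, b⟩ (h | h) <;> cases h <;> simp
  | link i e =>
    refine (Set.encard_le_encard (t := Set.range (fun e => (x, .link i e)) ∪
      Set.range ![(x, .tape i), (x + L.step, .tape i), (x, .copy i)]) ?_).trans
      ((encard_union_le_add (encard_range_le _) (encard_range_le _)).trans
        (Nat.cast_le.2 (by omega)))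
    rintro ⟨y, b⟩ (h | h) <;> cases h <;> simp
  | copy i =>
    refine (Set.encard_le_encard (t := Set.range (fun e => (x, .link i e)) ∪
      Set.range (fun c => (x, .probe i c))) ?_).trans
      ((encard_union_le_add (encard_range_le _) (encard_range_le _)).trans
        (Nat.cast_le.2 (by omega)))
    rintro ⟨y, b⟩ (h | h) <;> cases h <;> simp
  | hub =>
    refine (Set.encard_le_encard (t := Set.range (fun e => (x, .leaf e))) ?_).trans
      (encard_range_le _)
    rintro ⟨y, b⟩ (h | h) <;> cases h
    simp
  | leaf e =>
    refine (Set.encard_le_encard (t := {(x, .hub)}) ?_).trans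
      ((Set.encard_singleton _).le.trans (Nat.one_le_cast.2 (by omega)))
    rintro ⟨y, b⟩ (h | h) <;> cases h
    simp
  | _ => simp [Node.IsFree] at ha

theorem encard_le_one_of_subsingleton {α : Type*} {s : Set α} (h : s.Subsingleton) :
    s.encard ≤ (1 : ℕ) := by
  simpa using Set.encard_le_one_iff_subsingleton.2 h

theorem encard_gadgetNbrs_le_of_not_isFree {a : Node q γ} (x : ℕ) (ha : ¬ a.IsFree) :
    (L.gadgetNbrs x a).encard ≤ (3 : ℕ) := by
  have one : ∀ v : ℕ × Node q γ, ({v} : Set _).encard ≤ (1 : ℕ) := fun v => by simp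
  cases a with
  | flag =>
    refine (Set.encard_le_encard (t := {(x, .switch)} ∪ {(x - 1, .switch)}) ?_).trans
      ((encard_union_le_add (one _) (one _)).trans (Nat.cast_le.2 (by omega)))
    rintro ⟨y, b⟩ (h | h) <;> cases h <;> simp
  | switch =>
    refine (Set.encard_le_encard (t := {(x, .flag)} ∪ {(x + 1, .flag)} ∪
      {v | ∃ k, k.val = 0 ∧ v = (x, .wire k)}) ?_).trans
      ((encard_union_le_add (encard_union_le_add (one _) (one _))
        (encard_le_one_of_subsingleton ?_)))
    · rintro ⟨y, b⟩ (h | h) <;> cases h <;> simp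
      assumption
    · rintro _ ⟨k, hk, rfl⟩ _ ⟨k', hk', rfl⟩
      simp [Fin.ext_iff, hk, hk']
  | wire k =>
    refine (Set.encard_le_encard (t := {v | k.val = 0 ∧ v = (x, .switch) ∨
        ∃ k', k.val = k'.val + 1 ∧ v = (x, .wire k')} ∪
      {v | ∃ k', k'.val = k.val + 1 ∧ v = (x, .wire k')} ∪
      {v | ∃ (i : Fin γ) (c : Fin q), k.val = slot q i c ∧ v = (x, .probe i c)}) ?_).trans
      ((encard_union_le_add (encard_union_le_add (encard_le_one_of_subsingleton ?_)
        (encard_le_one_of_subsingleton ?_)) (encard_le_one_of_subsingleton ?_)))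
    · rintro ⟨y, b⟩ (h | h) <;> cases h <;> simp_all
    · rintro _ (⟨hk, rfl⟩ | ⟨k₁, hk, rfl⟩) _ (⟨hk', rfl⟩ | ⟨k₂, hk', rfl⟩)
      · rfl
      · omega
      · omega
      · simp [Fin.ext_iff]
        omega
    · rintro _ ⟨k₁, hk, rfl⟩ _ ⟨k₂, hk', rfl⟩
      simp [Fin.ext_iff, hk, hk']
    · rintro _ ⟨i, c, hk, rfl⟩ _ ⟨i', c', hk', rfl⟩
      obtain ⟨rfl, rfl⟩ := slot_injective (hk.symm.trans hk')
      rfl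
  | probe i c =>
    refine (Set.encard_le_encard (t := {v | ∃ k, k.val = slot q i c ∧ v = (x, .wire k)} ∪
      {(x, .copy i)}) ?_).trans
      ((encard_union_le_add (encard_le_one_of_subsingleton ?_) (one _)).trans
        (Nat.cast_le.2 (by omega)))
    · rintro ⟨y, b⟩ (h | h) <;> cases h <;> simp_all
    · rintro _ ⟨k, hk, rfl⟩ _ ⟨k', hk', rfl⟩
      simp [Fin.ext_iff, hk, hk']
  | _ => simp [Node.IsFree] at ha

variable (L)

/-- The neighbors of a vertex. -/
def nbrs (x : ℕ) (t : Site q γ) : Set (ℕ × Site q γ) :=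
  {v | L.Arc x t v.1 v.2 ∨ L.Arc v.1 v.2 x t}

variable {L}

/-- A vertex with a list has at most 3 gadget neighbors and, as some color is allowed, at most `q -
1` palette neighbors; `q + 2 ≤ 2 * q - 1` needs `q ≥ 3`. A palette vertex has one gadget neighbor
and at most `q - 1` neighbors on either side. -/
theorem encard_nbrs_le (hq : 3 ≤ q) (x : ℕ) (t : Site q γ) :
    (L.nbrs x t).encard ≤ (2 * q - 1 : ℕ) := by
  obtain ⟨a, _ | c⟩ := t
  · by_cases ha : a.IsFree
    · refine (Set.encard_le_encard
        (t := (fun v : ℕ × Node q γ => (v.1, (v.2, none))) '' L.gadgetNbrs x a) ?_).trans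
        ((Set.encard_image_le _ _).trans (encard_gadgetNbrs_le_of_isFree hq x ha))
      have hall : ∀ c, L.Allowed x a c := fun c => by
        cases a <;> simp [Node.IsFree] at ha <;> simp [Allowed]
      rintro ⟨y, b, _ | c⟩ (h | h)
      · exact ⟨(y, b), Or.inl (arc_none_none_iff.1 h), rfl⟩
      · exact ⟨(y, b), Or.inr (arc_none_none_iff.1 h), rfl⟩
      · exact absurd (hall _) (arc_none_some_iff.1 h).2.2
      · exact absurd h not_arc_some_none
    · obtain ⟨c₀, hc₀⟩ := exists_allowed (L := L) hq x ha
      refine (Set.encard_le_encard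
        (t := (fun v : ℕ × Node q γ => (v.1, (v.2, none))) '' L.gadgetNbrs x a ∪
          (fun c => (x, (a, some c))) '' (Finset.univ.erase c₀ : Finset (Fin q))) ?_).trans
        ((encard_union_le_add ((Set.encard_image_le _ _).trans
          (encard_gadgetNbrs_le_of_not_isFree x ha)) (encard_image_le_card _ _)).trans
          (Nat.cast_le.2 ?_))
      · rintro ⟨y, b, _ | c⟩ (h | h)
        · exact Or.inl ⟨(y, b), Or.inl (arc_none_none_iff.1 h), rfl⟩
        · exact Or.inl ⟨(y, b), Or.inr (arc_none_none_iff.1 h), rfl⟩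
        · obtain ⟨rfl, rfl, hc⟩ := arc_none_some_iff.1 h
          refine Or.inr ⟨c, ?_, rfl⟩
          simp only [Finset.coe_erase, Finset.coe_univ, Set.mem_sdiff, Set.mem_univ,
            Set.mem_singleton_iff, true_and]
          rintro rfl
          exact hc hc₀
        · exact absurd h not_arc_some_none
      · rw [Finset.card_erase_of_mem (Finset.mem_univ _), Finset.card_univ, Fintype.card_fin]
        omega
  · let F : ℕ → Fin q → ℕ × Site q γ := fun p c =>
      ((unpos (q := q) (γ := γ) p).1, ((unpos p).2, some c))
    refine (Set.encard_le_encard (t := {(x, (a, none))} ∪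
      F (pos x a + 1) '' (Finset.univ.erase c : Finset (Fin q)) ∪
      F (pos x a - 1) '' (Finset.univ.erase c : Finset (Fin q))) ?_).trans
      ((encard_union_le_add (encard_union_le_add (m := 1) (by simp) (encard_image_le_card _ _))
        (encard_image_le_card _ _)).trans (Nat.cast_le.2 ?_))
    · rintro ⟨y, b, _ | c'⟩ (h | h)
      · exact absurd h not_arc_some_none
      · obtain ⟨rfl, rfl, -⟩ := arc_none_some_iff.1 h
        exact Or.inl (Or.inl rfl)
      · obtain ⟨hc, h | ⟨rfl, rfl, h⟩⟩ := arc_some_some_iff.1 h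
        · refine Or.inl (Or.inr ⟨c', by simpa using hc.symm, ?_⟩)
          simp only [F, ← h, unpos_pos]
        · refine Or.inr ⟨c', by simpa using hc.symm, ?_⟩
          -- At position 0 there is no preceding palette; by truncated subtraction its place in the
          -- count is taken by the clique neighbors.
          have h' : pos x a - 1 = pos x a := by omega
          simp only [F, h', unpos_pos]
      · obtain ⟨hc, h | ⟨hx, hb, h⟩⟩ := arc_some_some_iff.1 h
        · refine Or.inr ⟨c', by simpa using hc, ?_⟩
          simp only [F, h, Nat.add_sub_cancel, unpos_pos]
        · refine Or.inr ⟨c', by simpa using hc, ?_⟩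
          have h' : pos y b - 1 = pos y b := by
            change pos y b = 0 at h
            omega
          rw [← hx, ← hb, h']
          simp only [F, unpos_pos]
    · rw [Finset.card_erase_of_mem (Finset.mem_univ _), Finset.card_univ, Fintype.card_fin]
      omega

/-! ### The graph with its path decomposition -/

variable (L)

/-- The vertex with block number `v.1` and site `v.2` is in the bag with number `i`. -/
def InBag (i : ℕ) (v : ℕ × Site q γ) : Prop :=
  v.1 = i ∨ v.1 = i + 1 ∨ i ≤ v.1 ∧ v.1 ≤ i + L.step ∧ ∃ j, v.2 = tapeSite q j

/-- The number of vertices of a block. -/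
noncomputable def blockSize (q γ : ℕ) : ℕ := Fintype.card (Site q γ)

/-- The block number and the site of a vertex given by its number. -/
noncomputable def decode {X : ℕ} (u : Fin (X * blockSize q γ)) : ℕ × Site q γ :=
  (u.divNat.val, (Fintype.equivFin (Site q γ)).symm u.modNat)

theorem decode_injective {X : ℕ} :
    Function.Injective (decode (q := q) (γ := γ) (X := X)) := by
  intro u v h
  simp only [decode, Prod.mk.injEq] at h
  exact finProdFinEquiv.symm.injective (Prod.ext (Fin.ext h.1) ((Equiv.injective _) h.2))

theorem decode_fst_lt {X : ℕ} (u : Fin (X * blockSize q γ)) : (decode u).1 < X :=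
  u.divNat.isLt

theorem exists_decode_eq {X : ℕ} {v : ℕ × Site q γ} (hv : v.1 < X) :
    ∃ u : Fin (X * blockSize q γ), decode u = v := by
  refine ⟨finProdFinEquiv (⟨v.1, hv⟩, Fintype.equivFin (Site q γ) v.2), ?_⟩
  have h := finProdFinEquiv.symm_apply_apply
    ((⟨v.1, hv⟩, Fintype.equivFin (Site q γ) v.2) : Fin X × Fin (blockSize q γ))
  have h1 := congrArg Prod.fst h
  have h2 := congrArg Prod.snd h
  simp only [finProdFinEquiv_symm_apply] at h1 h2
  simp only [decode, h1, h2]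
  simp

/-- The graph with `X` blocks. -/
def graph (q X : ℕ) : SimpleGraph (Fin (X * blockSize q γ)) where
  Adj u v := decode v ∈ L.nbrs (decode (q := q) u).1 (decode u).2
  symm := ⟨fun _ _ h => Or.symm h⟩
  loopless := ⟨fun _ h => h.elim (fun h => h.ne rfl) fun h => h.ne rfl⟩

open scoped Classical in
/-- The bags of a path decomposition of the graph with `X` blocks. -/
noncomputable def bag (q : ℕ) {X : ℕ} (i : Fin X) : Finset (Fin (X * blockSize q γ)) :=
  Finset.univ.filter fun u => L.InBag i (decode u)

/-- The graph with `X` blocks and its path decomposition. -/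
noncomputable def bagged (q X : ℕ) : BaggedGraph where
  numVerts := X * blockSize q γ
  graph := L.graph q X
  numBags := X
  bag := L.bag q

theorem graph_adj {X : ℕ} {u v : Fin (X * blockSize q γ)} :
    (L.graph q X).Adj u v ↔ decode v ∈ L.nbrs (decode u).1 (decode u).2 := Iff.rfl

theorem mem_bag {X : ℕ} {i : Fin X} {u : Fin (X * blockSize q γ)} :
    u ∈ L.bag q i ↔ L.InBag i (decode u) := by
  simp [bag]

theorem graph_colorable_iff (hq : 3 ≤ q) (X : ℕ) :
    (L.graph q X).Colorable q ↔ ∃ f : ℕ → Node q γ → Fin q, L.IsListColoring X f := by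
  constructor
  · rintro ⟨C⟩
    have : ∀ (x : ℕ) (t : Site q γ), ∃ c : Fin q, x < X →
        ∃ u : Fin (X * blockSize q γ), decode u = (x, t) ∧ C u = c := by
      intro x t
      by_cases hx : x < X
      · obtain ⟨u, hu⟩ := exists_decode_eq (v := (x, t)) hx
        exact ⟨C u, fun _ => ⟨u, hu, rfl⟩⟩
      · exact ⟨⟨0, by omega⟩, fun h => absurd h hx⟩
    choose f hf using this
    refine IsColoring.exists_isListColoring (f := f) fun x hx y hy t u h => ?_
    obtain ⟨v, hv, hvC⟩ := hf x t hx
    obtain ⟨w, hw, hwC⟩ := hf y u hy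
    rw [← hvC, ← hwC]
    refine C.valid ((L.graph_adj).2 (Or.inl ?_))
    rw [hv, hw]
    exact h
  · rintro ⟨f, hf⟩
    refine ⟨SimpleGraph.Coloring.mk
      (fun u : Fin (X * blockSize q γ) => (decode u).2.2.getD (f (decode u).1 (decode u).2.1))
      fun {u v} h => ?_⟩
    rcases (L.graph_adj).1 h with h | h
    · exact hf.isColoring _ (decode_fst_lt _) _ (decode_fst_lt _) _ _ h
    · exact (hf.isColoring _ (decode_fst_lt _) _ (decode_fst_lt _) _ _ h).symm

open scoped Classical in
theorem graph_maxDegree (hq : 3 ≤ q) {X : ℕ} (hX : 0 < X) :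
    (L.graph q X).maxDegree = 2 * q - 1 := by
  apply le_antisymm
  · refine SimpleGraph.maxDegree_le_of_forall_degree_le _ _ fun u => ?_
    have h := encard_nbrs_le (L := L) hq (decode (X := X) u).1 (decode u).2
    have h' : (decode '' ((L.graph q X).neighborFinset u : Set (Fin (X * blockSize q γ)))).encard
        ≤ (2 * q - 1 : ℕ) := by
      refine (Set.encard_le_encard ?_).trans h
      rintro _ ⟨v, hv, rfl⟩
      rw [Finset.mem_coe, SimpleGraph.mem_neighborFinset] at hv
      exact (L.graph_adj).1 hv
    rw [decode_injective.encard_image, Set.encard_coe_eq_coe_finsetCard, Nat.cast_le] at h'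
    exact h'
  · obtain ⟨u, hu⟩ := exists_decode_eq (q := q) (γ := γ) (X := X) (v := (0, (.hub, none))) hX
    have hl : ∀ e : Fin (2 * q - 1), ∃ w : Fin (X * blockSize q γ), decode w = (0, (.leaf e, none)) :=
      fun e => exists_decode_eq hX
    choose w hw using hl
    have hinj : Function.Injective w := fun e e' h => by
      have := (hw e).symm.trans ((congrArg decode h).trans (hw e'))
      simpa using this
    refine le_trans ?_ (SimpleGraph.degree_le_maxDegree (L.graph q X) u)
    calc 2 * q - 1 = (Finset.univ.image w).card := by
          rw [Finset.card_image_of_injective _ hinj, Finset.card_univ, Fintype.card_fin]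
      _ ≤ _ := by
          refine Finset.card_le_card fun v hv => ?_
          obtain ⟨e, -, rfl⟩ := Finset.mem_image.1 hv
          rw [SimpleGraph.mem_neighborFinset]
          refine (L.graph_adj).2 (Or.inl ?_)
          rw [hu, hw]
          exact .edge (.hub_leaf 0 e)

theorem bagged_isPathDecomposition (hstep : 0 < L.step) (X : ℕ) :
    (L.bagged q X).IsPathDecomposition where
  vertex_mem u := ⟨Fin.divNat (m := X) u, (L.mem_bag).2 (Or.inl rfl)⟩
  edge_mem u v h := by
    have key : ∀ u v : Fin (X * blockSize q γ), L.Arc (decode u).1 (decode u).2 (decode v).1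
        (decode v).2 → ∃ i : Fin X, u ∈ L.bag q i ∧ v ∈ L.bag q i := by
      intro u v h
      -- The bag numbered by the block of the tail of an arc also contains its head.
      refine ⟨u.divNat, (L.mem_bag).2 (Or.inl rfl), (L.mem_bag).2 ?_⟩
      rcases h.near with h | h | ⟨h, i, hi⟩
      · exact Or.inl h
      · exact Or.inr (Or.inl h)
      · exact Or.inr (Or.inr ⟨by rw [h]; exact Nat.le_add_right _ _, by rw [h]; rfl, i, hi⟩)
    rcases (L.graph_adj).1 h with h | h
    · exact key u v h
    · obtain ⟨i, h1, h2⟩ := key v u h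
      exact ⟨i, h2, h1⟩
  interval v i j k hij hjk hi hk := by
    replace hi := L.mem_bag.1 hi
    replace hk := L.mem_bag.1 hk
    refine L.mem_bag.2 ?_
    have hij' : i.val ≤ j.val := hij
    have hjk' : j.val ≤ k.val := hjk
    unfold InBag at *
    rcases hi with hi | hi | ⟨hi, hi', e⟩ <;> rcases hk with hk | hk | ⟨hk, hk', e'⟩
    all_goals first
      | (left; omega)
      | (right; left; omega)
      | (refine Or.inr (Or.inr ⟨by omega, by omega, by assumption⟩))
      | (rcases hij'.eq_or_lt with h | h <;> first | (left; omega) | (right; left; omega))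

/-- Only the tape vertices are paid for in `L.step + 1` blocks; everything else occurs in a bag for
just two blocks, which is a constant. -/
theorem bagged_width_le (X : ℕ) :
    (L.bagged q X).width ≤ 2 * blockSize q γ + (L.step + 1) * γ := by
  refine (Nat.sub_le _ _).trans (Finset.sup_le fun (i : Fin X) _ => ?_)
  have h : (decode '' (L.bag q i : Set (Fin (X * blockSize q γ)))).encard
      ≤ (2 * blockSize q γ + (L.step + 1) * γ : ℕ) := by
    refine (Set.encard_le_encard (t :=
      (fun v : Fin 2 × Site q γ => (i.val + v.1.val, v.2)) ''
        (Finset.univ : Finset (Fin 2 × Site q γ)) ∪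
      (fun v : Fin (L.step + 1) × Fin γ => (i.val + v.1.val, tapeSite q v.2)) ''
        (Finset.univ : Finset (Fin (L.step + 1) × Fin γ))) ?_).trans
      ((encard_union_le_add (encard_image_le_card _ _) (encard_image_le_card _ _)).trans
        (Nat.cast_le.2 ?_))
    · rintro _ ⟨u, hu, rfl⟩
      rcases (L.mem_bag).1 hu with h | h | ⟨h, h', j, hj⟩
      · exact Or.inl ⟨(0, (decode u).2), by simp, Prod.ext h.symm rfl⟩
      · exact Or.inl ⟨(1, (decode u).2), by simp, Prod.ext h.symm rfl⟩
      · refine Or.inr ⟨(⟨(decode u).1 - i.val, by omega⟩, j), by simp, Prod.ext ?_ hj.symm⟩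
        simp only
        omega
    · simp [blockSize]
  rw [decode_injective.encard_image, Set.encard_coe_eq_coe_finsetCard, Nat.cast_le] at h
  exact h

end Layout

/-! ### The layout that belongs to a formula -/

/-- The number with given binary digits. -/
theorem exists_lt_two_pow_digits (β : ℕ) (f : ℕ → Bool) :
    ∃ k < 2 ^ β, ∀ i < β, k / 2 ^ i % 2 = (f i).toNat := by
  induction β generalizing f with
  | zero => exact ⟨0, by simp, by simp⟩
  | succ β ih =>
    obtain ⟨k, hk, h⟩ := ih fun i => f (i + 1)
    have h0 : (f 0).toNat < 2 := by cases f 0 <;> simp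
    refine ⟨2 * k + (f 0).toNat, by rw [pow_succ]; omega, fun i hi => ?_⟩
    cases i with
    | zero => simp; omega
    | succ i =>
      rw [pow_succ', ← Nat.div_div_eq_div_mul, ← h i (by omega)]
      congr 2
      omega

/-- A number is determined by its digits. -/
theorem eq_of_digits_eq {q γ k k' : ℕ} (hk : k < q ^ γ) (hk' : k' < q ^ γ)
    (h : ∀ i < γ, k / q ^ i % q = k' / q ^ i % q) : k = k' := by
  induction γ generalizing k k' with
  | zero => simp at hk hk'; omega
  | succ γ ih =>
    have h0 := h 0 (by omega)
    simp only [pow_zero, Nat.div_one] at h0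
    rw [pow_succ'] at hk hk'
    have := ih (Nat.div_lt_of_lt_mul hk) (Nat.div_lt_of_lt_mul hk') fun i hi => by
      have := h (i + 1) (by omega)
      rwa [pow_succ', ← Nat.div_div_eq_div_mul, ← Nat.div_div_eq_div_mul] at this
    rw [← Nat.div_add_mod k q, ← Nat.div_add_mod k' q, this, h0]

/-- Injectivity leaves exactly one of the `q` colors outside the range of `g`. This is how a clique
of size `q - 1` makes its common neighbors equal. -/
theorem eq_of_notMem_range {q : ℕ} {g : Fin (q - 1) → Fin q} (hg : Function.Injective g)
    {a b : Fin q} (ha : ∀ e, g e ≠ a) (hb : ∀ e, g e ≠ b) : a = b := by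
  by_contra hab
  have h1 : (insert a (insert b (Finset.univ.image g))).card = q - 1 + 1 + 1 := by
    rw [Finset.card_insert_of_notMem, Finset.card_insert_of_notMem,
      Finset.card_image_of_injective _ hg, Finset.card_univ, Fintype.card_fin]
    · simpa using hb
    · simpa [hab] using ha
  have h2 := Finset.card_le_univ (insert a (insert b (Finset.univ.image g)))
  rw [h1, Fintype.card_fin] at h2
  omega

theorem RAM.rowMajor_ne_zero_iff {r c : ℕ} (M : Fin r → Fin c → Prop) (i : ℕ) (j : Fin c) :
    rowMajor M (i * c + j) ≠ 0 ↔ ∃ hi : i < r, M ⟨i, hi⟩ j := by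
  unfold rowMajor
  rw [show ∀ (p : Prop) [Decidable p], (if p then 1 else 0) ≠ 0 ↔ p from fun p _ => by simp]
  constructor
  · rintro ⟨i', j', h, hM⟩
    have hc : 0 < c := j.pos
    have h1 : i = i' := by
      have := congrArg (· / c) h
      simpa [mul_comm _ c, Nat.mul_add_div hc, Nat.div_eq_of_lt j.isLt,
        Nat.div_eq_of_lt j'.isLt] using this
    subst h1
    have h2 : j = j' := Fin.ext (by omega)
    subst h2
    exact ⟨i'.isLt, hM⟩
  · rintro ⟨hi, hM⟩
    exact ⟨⟨i, hi⟩, j, rfl, hM⟩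

theorem RAM.rowMajor_le_one {r c : ℕ} (M : Fin r → Fin c → Prop) (k : ℕ) : rowMajor M k ≤ 1 := by
  unfold rowMajor
  split_ifs <;> simp

theorem RAM.rowMajor_eq_zero {r c : ℕ} (M : Fin r → Fin c → Prop) {k : ℕ} (hk : r * c ≤ k) :
    rowMajor M k = 0 := by
  unfold rowMajor
  rw [if_neg]
  rintro ⟨i, j, rfl, -⟩
  have h : (i.val + 1) * c ≤ r * c := Nat.mul_le_mul_right c i.isLt
  have h' : (i.val + 1) * c = i * c + c := by ring
  omega

/-- The number of groups of `β` variables. -/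
def numGroups (β n : ℕ) : ℕ := n / β + 1

/-- The number of blocks that belong to a clause. -/
def clauseLength (β n : ℕ) : ℕ := 2 ^ β * numGroups β n

/-- The layout for a formula with `n` variables and the incidence matrices `inp`. Block `x` belongs
to group `x % numGroups β n` of `β` variables, to one of their `2 ^ β` assignments, and to clause
`x / clauseLength β n`. -/
def satLayout (q β γ n : ℕ) (inp : Bool → ℕ → ℕ) : Layout γ where
  step := numGroups β n
  first x := x % clauseLength β n = 0
  last x := (x + 1) % clauseLength β n = 0
  active x := ∃ (i : Fin β) (b : Bool), x % numGroups β n * β + i < n ∧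
    x / numGroups β n % 2 ^ β / 2 ^ i.val % 2 = b.toNat ∧
    inp b (x / numGroups β n / 2 ^ β * n + (x % numGroups β n * β + i)) ≠ 0
  word x i := x / numGroups β n % 2 ^ β / q ^ i.val % q

/-- The incidence matrices of a formula. -/
noncomputable def CNF.incidence (φ : CNF) (b : Bool) : ℕ → ℕ :=
  RAM.rowMajor fun j i => (i, b) ∈ φ.clause j

theorem CNF.incidence_ne_zero_iff (φ : CNF) (b : Bool) (j : ℕ) {v : ℕ} (hv : v < φ.numVars) :
    φ.incidence b (j * φ.numVars + v) ≠ 0 ↔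
      ∃ hj : j < φ.numClauses, (⟨v, hv⟩, b) ∈ φ.clause ⟨j, hj⟩ :=
  RAM.rowMajor_ne_zero_iff _ j ⟨v, hv⟩

section

variable {q β γ : ℕ}

theorem numGroups_pos (β n : ℕ) : 0 < numGroups β n := Nat.succ_pos _

theorem div_clauseLength (β n x : ℕ) :
    x / clauseLength β n = x / numGroups β n / 2 ^ β := by
  rw [clauseLength, mul_comm, Nat.div_div_eq_div_mul]

/-! ### What a list coloring forces -/

namespace Layout.IsListColoring

variable {L : Layout γ} {X : ℕ} {f : ℕ → Node q γ → Fin q} (hf : L.IsListColoring X f)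

include hf

theorem link_injective {x : ℕ} (hx : x < X) (i : Fin γ) :
    Function.Injective fun e => f x (.link i e) := by
  intro e e' h
  by_contra hne
  exact hf.proper x hx x hx _ _ (.link_link x i e e' hne) h

theorem tape_add_step {x : ℕ} (hx : x + L.step < X) (i : Fin γ) :
    f (x + L.step) (.tape i) = f x (.tape i) := by
  have hx' : x < X := by omega
  exact eq_of_notMem_range (hf.link_injective hx' i)
    (fun e => hf.proper _ hx' _ hx _ _ (.link_tape x i e))
    (fun e => (hf.proper _ hx' _ hx' _ _ (.tape_link x i e)).symm)

theorem copy_eq_tape {x : ℕ} (hx : x < X) (i : Fin γ) : f x (.copy i) = f x (.tape i) :=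
  eq_of_notMem_range (hf.link_injective hx i)
    (fun e => hf.proper _ hx _ hx _ _ (.link_copy x i e))
    (fun e => (hf.proper _ hx _ hx _ _ (.tape_link x i e)).symm)

theorem tape_mod_step {x : ℕ} (hx : x < X) (hs : 0 < L.step) (i : Fin γ) :
    f (x % L.step) (.tape i) = f x (.tape i) := by
  induction x using Nat.strong_induction_on with
  | _ x ih =>
    rcases lt_or_ge x L.step with h | h
    · rw [Nat.mod_eq_of_lt h]
    · have h1 := ih (x - L.step) (by omega) (by omega)
      have h2 := hf.tape_add_step (x := x - L.step) (by omega) i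
      rw [Nat.sub_add_cancel h] at h2
      rw [h2, ← h1, Nat.mod_eq_sub_mod h]

theorem tape_of_switch {x : ℕ} (hx : x < X) (h : (f x .switch).val = 2) (i : Fin γ) :
    (f x (.tape i)).val = L.word x i := by
  -- As `tone 0 = 2`, a switch of color 2 excludes the first color of the list at the start of the
  -- wire; then each wire vertex excludes the first color of the next one.
  have hwire : ∀ (k : ℕ) (hk : k < 3 * (γ * q)), (f x (.wire ⟨k, hk⟩)).val = tone (k + 1) := by
    intro k
    induction k with
    | zero =>
      intro hk
      have h1 := Fin.val_ne_of_ne (hf.proper x hx x hx _ _ (.switch_wire x ⟨0, hk⟩ rfl))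
      rcases hf.allowed x hx (.wire ⟨0, hk⟩) with h2 | h2
      · rw [h2, h] at h1
        exact absurd rfl h1
      · exact h2
    | succ k ih =>
      intro hk
      have h1 := Fin.val_ne_of_ne (hf.proper x hx x hx _ _
        (.wire_wire x ⟨k, by omega⟩ ⟨k + 1, hk⟩ rfl))
      rw [ih] at h1
      rcases hf.allowed x hx (.wire ⟨k + 1, hk⟩) with h2 | h2
      · exact absurd h2.symm h1
      · exact h2
  -- The wire vertex at the slot of the probe has used up the second color of the list of the probe.
  have hprobe : ∀ c : Fin q, f x (.probe i c) = c := by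
    intro c
    have h1 := Fin.val_ne_of_ne (hf.proper x hx x hx _ _
      (.wire_probe x ⟨slot q i c, slot_lt i c⟩ i c rfl))
    rw [hwire] at h1
    rcases hf.allowed x hx (.probe i c) with h2 | h2
    · exact Fin.ext h2
    · exact absurd h2.symm h1
  rw [← hf.copy_eq_tape hx]
  by_contra hne
  exact hf.proper x hx x hx _ _ (.probe_copy x i _ hne) (hprobe _)

theorem active_of_switch {x : ℕ} (hx : x < X) (h : (f x .switch).val = 2) : L.active x := by
  rcases hf.allowed x hx .switch with h1 | ⟨h1, -⟩ | ⟨-, h1⟩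
  · omega
  · omega
  · exact h1

end Layout.IsListColoring

/-- Suppose no switch of the clause has color 2. The first flag is 0, so the switch is 1, so the
next flag is 0, and so on; but the last switch of the clause may not be 1. -/
theorem exists_switch {n S j : ℕ} {inp : Bool → ℕ → ℕ} {X : ℕ} {f : ℕ → Node q γ → Fin q}
    (hf : (satLayout q β γ n inp).IsListColoring X f) (hS : S = clauseLength β n)
    (hj : (j + 1) * S ≤ X) : ∃ x, x / S = j ∧ x < X ∧ (f x .switch).val = 2 := by
  have hS0 : 0 < S := hS ▸ Nat.mul_pos (by positivity) (numGroups_pos β n)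
  have hexp : (j + 1) * S = j * S + S := by ring
  by_contra! hno
  have hno' : ∀ t < S, (f (j * S + t) .switch).val ≠ 2 := fun t ht =>
    hno _ (by rw [mul_comm, Nat.mul_add_div hS0, Nat.div_eq_of_lt ht, add_zero]) (by omega)
  have hflag : ∀ t < S, (f (j * S + t) .flag).val = 0 := by
    intro t
    induction t with
    | zero =>
      intro _
      rcases hf.allowed (j * S) (by omega) .flag with h | ⟨-, h⟩
      · exact h
      · exact absurd (show j * S % clauseLength β n = 0 by simp [hS]) h
    | succ t ih =>
      intro ht
      have h0 := ih (by omega)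
      have h1 := Fin.val_ne_of_ne (hf.proper (j * S + t) (by omega) _ (by omega) _ _
        (.flag_switch (j * S + t)))
      have h2 : (f (j * S + t) .switch).val = 1 := by
        rcases hf.allowed (j * S + t) (by omega) .switch with h | ⟨h, -⟩ | ⟨h, -⟩
        · omega
        · exact h
        · exact absurd h (hno' t (by omega))
      have h3 := Fin.val_ne_of_ne (hf.proper (j * S + t) (by omega) (j * S + t + 1) (by omega) _ _
        (.switch_flag (j * S + t) (by
          show ¬ (j * S + t + 1) % clauseLength β n = 0
          rw [← hS, add_assoc, mul_comm, Nat.mul_add_mod, Nat.mod_eq_of_lt ht]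
          omega)))
      rcases hf.allowed (j * S + (t + 1)) (by omega) .flag with h | ⟨h, -⟩
      · exact h
      · rw [h2] at h3
        exact absurd h.symm h3
  have h0 := hflag (S - 1) (by omega)
  have h1 := Fin.val_ne_of_ne (hf.proper (j * S + (S - 1)) (by omega) _ (by omega) _ _
        (.flag_switch (j * S + (S - 1))))
  rcases hf.allowed (j * S + (S - 1)) (by omega) .switch with h | ⟨-, h⟩ | ⟨h, -⟩
  · omega
  · refine h ?_
    show (j * S + (S - 1) + 1) % clauseLength β n = 0
    rw [← hS, show j * S + (S - 1) + 1 = (j + 1) * S by omega, Nat.mul_mod_left]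
  · exact hno' _ (by omega) h

theorem satisfiable_of_isListColoring (hpow : 2 ^ β ≤ q ^ γ) (φ : CNF) {f : ℕ → Node q γ → Fin q}
    (hf : (satLayout q β γ φ.numVars φ.incidence).IsListColoring
      (φ.numClauses * clauseLength β φ.numVars + 1) f) : φ.Satisfiable := by
  set n := φ.numVars with hn
  set g := numGroups β n with hg
  -- The tape of block `h`, for `h` below the number of groups, spells at most one assignment
  -- because `2 ^ β ≤ q ^ γ`; if it spells none, the choice 0 is arbitrary.
  have hex : ∀ h : ℕ, ∃ k, ∀ k' < 2 ^ β, (∀ i : Fin γ, (f h (.tape i)).val = k' / q ^ i.val % q) →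
      k' = k := by
    intro h
    by_cases H : ∃ k < 2 ^ β, ∀ i : Fin γ, (f h (.tape i)).val = k / q ^ i.val % q
    · obtain ⟨k, hk, hk'⟩ := H
      exact ⟨k, fun k' h1 h2 => eq_of_digits_eq (h1.trans_le hpow) (hk.trans_le hpow)
        fun i hi => (h2 ⟨i, hi⟩).symm.trans (hk' ⟨i, hi⟩)⟩
    · exact ⟨0, fun k' h1 h2 => absurd ⟨k', h1, h2⟩ H⟩
  choose K hK using hex
  refine ⟨fun v => decide (K (v / β) / 2 ^ (v.val % β) % 2 = 1), fun j => ?_⟩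
  obtain ⟨x, hxj, hxX, hx2⟩ := exists_switch (j := j) hf rfl
    ((Nat.mul_le_mul_right _ j.isLt).trans (Nat.le_succ _))
  obtain ⟨i, b, hin, hbit, hinp⟩ := hf.active_of_switch hxX hx2
  rw [← hg] at hin hbit hinp
  have hword := fun i => (congrArg Fin.val (hf.tape_mod_step hxX (numGroups_pos β n) i)).trans
    (hf.tape_of_switch hxX hx2 i)
  have hKx := hK (x % g) (x / g % 2 ^ β) (Nat.mod_lt _ (by positivity)) hword
  rw [← div_clauseLength, hxj, φ.incidence_ne_zero_iff b j hin] at hinp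
  obtain ⟨hj, hmem⟩ := hinp
  refine ⟨_, hmem, ?_⟩
  have hd : (x % g * β + i) / β = x % g := by
    rw [mul_comm, Nat.mul_add_div i.pos, Nat.div_eq_of_lt i.isLt, add_zero]
  have hm : (x % g * β + i) % β = i := by
    rw [mul_comm, Nat.mul_add_mod, Nat.mod_eq_of_lt i.isLt]
  simp only [hd, hm, ← hKx, hbit]
  cases b <;> simp

/-! ### Colorings from satisfying assignments -/

/-- The colors of a list coloring that encodes an assignment. The assignment of group `h` is `K h`,
and clause `j` becomes satisfied in block `T j`. -/
def encodeColor (q : ℕ) {γ : ℕ} (g S : ℕ) (K T : ℕ → ℕ) (x : ℕ) : Node q γ → ℕ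
  | .tape i | .copy i => K (x % g) / q ^ i.val % q
  | .link i e => if e.val < K (x % g) / q ^ i.val % q then e else e + 1
  | .flag => if T (x / S) < x then 1 else 0
  | .switch => if x = T (x / S) then 2 else if T (x / S) < x then 0 else 1
  | .wire k => if x = T (x / S) then tone (k + 1) else tone k
  | .probe i c => if x = T (x / S) then c else
      if K (x % g) / q ^ i.val % q = c then tone (slot q i c + 1) else c
  | .hub => 0
  | .leaf _ => 1

theorem encodeColor_lt (hq : 3 ≤ q) (g S : ℕ) (K T : ℕ → ℕ) (x : ℕ) (a : Node q γ) :
    encodeColor q g S K T x a < q := by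
  have ht : ∀ k, tone k < q := fun k => (tone_lt k).trans_le hq
  cases a with
  | tape i => exact Nat.mod_lt _ (by omega)
  | copy i => exact Nat.mod_lt _ (by omega)
  | link i e =>
    have := e.isLt
    simp only [encodeColor]
    split_ifs <;> omega
  | flag => simp only [encodeColor]; split_ifs <;> omega
  | switch => simp only [encodeColor]; split_ifs <;> omega
  | wire k => simp only [encodeColor]; split_ifs <;> exact ht _
  | probe i c => simp only [encodeColor]; split_ifs <;> first | exact ht _ | exact c.isLt
  | hub => simp only [encodeColor]; omega
  | leaf e => simp only [encodeColor]; omega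

/-- Before block `T j` of clause `j` flags and switches are 0 and 1, after it 1 and 0. Away from `T
j` the wire stays in its rest state, and each probe can avoid the color of the copy. In block `T j`
all probes show their own color, which is harmless since the tape spells the word of the block. -/
theorem isListColoring_encodeColor (hq : 3 ≤ q) (hβ : 0 < β) {n m : ℕ} {inp : Bool → ℕ → ℕ}
    {K T : ℕ → ℕ}
    (hT : ∀ j, j * clauseLength β n ≤ T j)
    (hT' : ∀ j < m, T j < (j + 1) * clauseLength β n)
    (hT'' : ∀ j ≥ m, (j + 1) * clauseLength β n ≤ T j)
    (hact : ∀ j < m, (satLayout q β γ n inp).active (T j))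
    (hword : ∀ j < m, T j / numGroups β n % 2 ^ β = K (T j % numGroups β n)) :
    (satLayout q β γ n inp).IsListColoring (m * clauseLength β n + 1) fun x (a : Node q γ) =>
      ⟨encodeColor q (numGroups β n) (clauseLength β n) K T x a, encodeColor_lt hq _ _ _ _ _ _⟩ := by
  -- There is one block after the last clause, with its switch at color 1. A clause length of at
  -- least 2 ensures that this block does not end a clause.
  have hS : 2 ≤ clauseLength β n := by
    have h1 : 2 ^ 1 ≤ 2 ^ β := Nat.pow_le_pow_right (by omega) hβ
    have h2 := numGroups_pos β n
    calc 2 = 2 ^ 1 * 1 := rfl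
      _ ≤ _ := Nat.mul_le_mul h1 h2
  generalize hSd : clauseLength β n = S at *
  have hdm : ∀ x, x / S * S + x % S = x := fun x => Nat.div_add_mod' x S
  have hm : ∀ x, x = T (x / S) → x / S < m := by
    intro x hx
    by_contra h
    have h1 := hT'' (x / S) (by omega)
    have h2 := hdm x
    have h3 := Nat.mod_lt x (show 0 < S by omega)
    have h4 : (x / S + 1) * S = x / S * S + S := by ring
    omega
  constructor
  · intro x hx a
    cases a with
    | flag =>
      simp only [encodeColor, Layout.Allowed]
      split_ifs with h
      · refine Or.inr ⟨rfl, fun h0 => ?_⟩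
        have h0 : x % S = 0 := hSd ▸ h0
        have h1 := hT (x / S)
        have h2 := hdm x
        omega
      · exact Or.inl rfl
    | switch =>
      simp only [encodeColor, Layout.Allowed]
      split_ifs with h h'
      · refine Or.inr (Or.inr ⟨rfl, ?_⟩)
        have := hact _ (hm x h)
        rwa [← h] at this
      · exact Or.inl rfl
      · refine Or.inr (Or.inl ⟨rfl, fun h0 => ?_⟩)
        have h0 : (x + 1) % S = 0 := hSd ▸ h0
        have h2 := hdm x
        have h3 := Nat.mod_lt x (show 0 < S by omega)
        have h4 : (x / S + 1) * S = x / S * S + S := by ring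
        have h5 : x + 1 = (x / S + 1) * S := by
          obtain ⟨z, hz⟩ := Nat.dvd_of_mod_eq_zero h0
          have h6 : x / S < z := by
            by_contra hc
            have : S * z ≤ S * (x / S) := Nat.mul_le_mul_left _ (by omega)
            rw [mul_comm S (x / S)] at this
            omega
          have h7 : S * (x / S + 1) ≤ S * z := Nat.mul_le_mul_left _ h6
          rw [mul_comm S (x / S + 1)] at h7
          omega
        rcases lt_or_ge (x / S) m with hxm | hxm
        · have := hT' _ hxm
          omega
        · have : m * S ≤ x / S * S := Nat.mul_le_mul_right _ hxm
          omega
    | wire k =>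
      simp only [encodeColor, Layout.Allowed]
      split_ifs <;> simp
    | probe i c =>
      simp only [encodeColor, Layout.Allowed]
      split_ifs <;> simp
    | _ => trivial
  · intro x hx y hy a b h
    rw [ne_eq, Fin.mk.injEq]
    cases h with
    | tape_link i e => simp only [encodeColor]; split_ifs <;> omega
    | link_tape i e =>
      simp only [encodeColor, satLayout, Nat.add_mod_right]
      split_ifs <;> omega
    | link_link i e e' hne =>
      have := Fin.val_ne_of_ne hne
      simp only [encodeColor]
      split_ifs <;> omega
    | link_copy i e => simp only [encodeColor]; split_ifs <;> omega
    | flag_switch => simp only [encodeColor]; split_ifs <;> first | omega | simp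
    | switch_flag hl =>
      have hl' : (x + 1) / S = x / S := by
        refine Nat.succ_div_of_not_dvd fun h => hl ?_
        show (x + 1) % clauseLength β n = 0
        rw [hSd]
        exact Nat.mod_eq_zero_of_dvd h
      simp only [encodeColor, hl']
      split_ifs <;> first | omega | simp
    | switch_wire k hk =>
      simp only [encodeColor, tone, hk]
      split_ifs <;> first | omega | simp
    | wire_wire k k' hk =>
      simp only [encodeColor, hk]
      split_ifs
      · exact (tone_succ_ne _).symm
      · exact (tone_succ_ne _).symm
    | wire_probe k i c hk =>
      simp only [encodeColor, hk]
      split_ifs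
      · exact tone_slot_succ_ne _ _ _
      · exact (tone_succ_ne _).symm
      · exact tone_slot_ne _ _ _
    | probe_copy i c hc =>
      simp only [encodeColor]
      split_ifs with h h'
      · intro h'
        refine hc (h'.trans ?_)
        have := hword _ (hm x h)
        rw [← h] at this
        simp only [satLayout, this]
      · rw [h']
        exact tone_slot_succ_ne _ _ _
      · exact fun h => h' h.symm
    | hub_leaf e => simp [encodeColor]

theorem exists_isListColoring_of_satisfiable (hq : 3 ≤ q) (hβ : 0 < β) {φ : CNF}
    (hφ : φ.Satisfiable) : ∃ f : ℕ → Node q γ → Fin q,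
      (satLayout q β γ φ.numVars φ.incidence).IsListColoring
        (φ.numClauses * clauseLength β φ.numVars + 1) f := by
  set n := φ.numVars with hn
  set m := φ.numClauses with hm
  set g := numGroups β n with hg
  obtain ⟨α, hα⟩ := hφ
  have hK : ∀ h : ℕ, ∃ k < 2 ^ β, ∀ i < β, k / 2 ^ i % 2 =
      (if hv : h * β + i < n then α ⟨h * β + i, hv⟩ else false).toNat :=
    fun h => exists_lt_two_pow_digits β _
  choose K hK hbit using hK
  have hT : ∀ j, ∃ x, j * clauseLength β n ≤ x ∧ (j < m → x < (j + 1) * clauseLength β n ∧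
      (satLayout q β γ n φ.incidence).active x ∧ x / g % 2 ^ β = K (x % g)) ∧
      (m ≤ j → (j + 1) * clauseLength β n ≤ x) := by
    intro j
    rcases lt_or_ge j m with hj | hj
    swap
    · exact ⟨(j + 1) * clauseLength β n, Nat.mul_le_mul_right _ (Nat.le_succ j),
        fun h => absurd h (by omega), fun _ => le_rfl⟩
    obtain ⟨⟨v, b⟩, hl, hlα⟩ := hα ⟨j, hj⟩
    simp only at hlα
    set h := v.val / β with hh
    have hhg : h < g := Nat.lt_succ_of_le (Nat.div_le_div_right v.isLt.le)
    have hvh : h * β + v.val % β = v := Nat.div_add_mod' _ _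
    have hvβ : v.val % β < β := Nat.mod_lt _ hβ
    have e1 : ((j * 2 ^ β + K h) * g + h) / g = j * 2 ^ β + K h := by
      rw [mul_comm, Nat.mul_add_div (numGroups_pos β n), Nat.div_eq_of_lt hhg, add_zero]
    have e2 : ((j * 2 ^ β + K h) * g + h) % g = h := by
      rw [mul_comm, Nat.mul_add_mod, Nat.mod_eq_of_lt hhg]
    have e3 : (j * 2 ^ β + K h) % 2 ^ β = K h := by
      rw [mul_comm, Nat.mul_add_mod, Nat.mod_eq_of_lt (hK h)]
    have e4 : (j * 2 ^ β + K h) / 2 ^ β = j := by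
      rw [mul_comm, Nat.mul_add_div (by positivity), Nat.div_eq_of_lt (hK h), add_zero]
    -- The block of clause `j`, assignment `K h` and group `h`, where `h` is the group of a variable
    -- whose literal satisfies the clause.
    refine ⟨(j * 2 ^ β + K h) * g + h, ?_, fun _ => ⟨?_, ?_, ?_⟩, fun h => absurd h (by omega)⟩
    · calc j * clauseLength β n = j * 2 ^ β * g := by rw [clauseLength, mul_assoc]
        _ ≤ (j * 2 ^ β + K h) * g := Nat.mul_le_mul_right _ (Nat.le_add_right _ _)
        _ ≤ _ := Nat.le_add_right _ _
    · calc (j * 2 ^ β + K h) * g + h < (j * 2 ^ β + K h) * g + g := by omega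
        _ = (j * 2 ^ β + (K h + 1)) * g := by ring
        _ ≤ (j * 2 ^ β + 2 ^ β) * g := Nat.mul_le_mul_right _ (Nat.add_le_add_left (hK h) _)
        _ = (j + 1) * clauseLength β n := by rw [clauseLength]; ring
    · refine ⟨⟨v.val % β, hvβ⟩, b, ?_, ?_, ?_⟩
      · rw [← hg, e2]
        simp only [hvh]
        exact v.isLt
      · rw [← hg, e1, e3, hbit h _ hvβ]
        have hv : v.val < n := v.isLt
        simp only [hvh, dif_pos hv]
        exact congrArg Bool.toNat hlα
      · rw [← hg, e1, e2, e4]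
        simp only [hvh]
        exact (φ.incidence_ne_zero_iff b j v.isLt).2 ⟨hj, hl⟩
    · rw [e1, e2, e3]
  choose T hT₁ hT₂ hT₃ using hT
  exact ⟨_, isListColoring_encodeColor (m := m) (K := K) (T := T) hq hβ hT₁
    (fun j hj => (hT₂ j hj).1) hT₃ (fun j hj => (hT₂ j hj).2.1) (fun j hj => (hT₂ j hj).2.2)⟩

end

open RAM

/-! ### Definability of the graph -/

namespace Layout

variable {q γ : ℕ}

/-- All parts of a layout that depends on the context are definable. -/
structure IsDefinable (L : Ctx → Layout γ) : Prop where
  step : DefFun fun Γ => (L Γ).step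
  first : ∀ F, DefFun F → DefPred fun Γ => (L Γ).first (F Γ)
  last : ∀ F, DefFun F → DefPred fun Γ => (L Γ).last (F Γ)
  active : ∀ F, DefFun F → DefPred fun Γ => (L Γ).active (F Γ)
  word : ∀ F, DefFun F → ∀ i, DefFun fun Γ => (L Γ).word (F Γ) i

/-- The conditions on the nodes are separated from those on block numbers and layout. The former are
constants for definability, the latter are arithmetic. -/
theorem edge_iff {L : Layout γ} {x y : ℕ} {a b : Node q γ} :
    L.Edge x a y b ↔
      (x = y ∧ ((∃ i e, a = .tape i ∧ b = .link i e) ∨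
        (∃ i e e', (a = .link i e ∧ b = .link i e') ∧ e ≠ e') ∨
        (∃ i e, a = .link i e ∧ b = .copy i) ∨ (a = .flag ∧ b = .switch) ∨
        (∃ k, (a = .switch ∧ b = .wire k) ∧ k.val = 0) ∨
        (∃ k k', (a = .wire k ∧ b = .wire k') ∧ k'.val = k.val + 1) ∨
        (∃ k i c, (a = .wire k ∧ b = .probe i c) ∧ k.val = slot q i c) ∨
        (∃ e, a = .hub ∧ b = .leaf e))) ∨
      (y = x + L.step ∧ ∃ i e, a = .link i e ∧ b = .tape i) ∨
      ((y = x + 1 ∧ ¬ L.last x) ∧ a = .switch ∧ b = .flag) ∨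
      (x = y ∧ ∃ (i : Fin γ) (c : Fin q), c.val ≠ L.word x i ∧ a = .probe i c ∧ b = .copy i) := by
  constructor
  · intro h
    cases h <;> simp_all
  · rintro (⟨rfl, h⟩ | ⟨rfl, i, e, rfl, rfl⟩ | ⟨⟨rfl, h⟩, rfl, rfl⟩ | ⟨rfl, i, c, h, rfl, rfl⟩)
    · rcases h with ⟨i, e, rfl, rfl⟩ | ⟨i, e, e', ⟨rfl, rfl⟩, h⟩ | ⟨i, e, rfl, rfl⟩ | ⟨rfl, rfl⟩ |
        ⟨k, ⟨rfl, rfl⟩, h⟩ | ⟨k, k', ⟨rfl, rfl⟩, h⟩ | ⟨k, i, c, ⟨rfl, rfl⟩, h⟩ | ⟨e, rfl, rfl⟩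
      · exact .tape_link x i e
      · exact .link_link x i e e' h
      · exact .link_copy x i e
      · exact .flag_switch x
      · exact .switch_wire x k h
      · exact .wire_wire x k k' h
      · exact .wire_probe x k i c h
      · exact .hub_leaf x e
    · exact .link_tape x i e
    · exact .switch_flag x h
    · exact .probe_copy x i c h

/-- The vertices with the numbers `u` and `v` are adjacent. -/
def NumAdj (L : Layout γ) (q u v : ℕ) : Prop :=
  ∃ t w : Site q γ, u % blockSize q γ = Fintype.equivFin _ t ∧
    v % blockSize q γ = Fintype.equivFin _ w ∧ (v / blockSize q γ, w) ∈ L.nbrs (u / blockSize q γ) t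

/-- The vertex with the number `v` is in the bag with the number `i`. -/
def NumInBag (L : Layout γ) (q i v : ℕ) : Prop :=
  ∃ t : Site q γ, v % blockSize q γ = Fintype.equivFin _ t ∧ L.InBag i (v / blockSize q γ, t)

namespace IsDefinable

variable {L : Ctx → Layout γ} (hL : IsDefinable L) {F G : Ctx → ℕ}

include hL

theorem edge (hF : DefFun F) (hG : DefFun G) (a b : Node q γ) :
    DefPred fun Γ => (L Γ).Edge (F Γ) a (G Γ) b := by
  simp only [edge_iff]
  exact ((DefPred.eq hF hG).and (.const _)).or
    (((DefPred.eq hG (hF.add hL.step)).and (.const _)).or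
    ((((DefPred.eq hG (hF.add (.const 1))).and (hL.last F hF).not).and (.const _)).or
    ((DefPred.eq hF hG).and (DefPred.exists_finite fun i => DefPred.exists_finite fun c =>
      (DefPred.eq (.const _) (hL.word F hF i)).not.and (.const _)))))

theorem allowed (hF : DefFun F) (a : Node q γ) (c : ℕ) :
    DefPred fun Γ => (L Γ).Allowed (F Γ) a c := by
  cases a with
  | flag => exact (DefPred.const _).or ((DefPred.const _).and (hL.first F hF).not)
  | switch =>
    exact (DefPred.const _).or (((DefPred.const _).and (hL.last F hF).not).or
      ((DefPred.const _).and (hL.active F hF)))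
  | _ => exact .const _

theorem arc (hF : DefFun F) (hG : DefFun G) (t u : Site q γ) :
    DefPred fun Γ => (L Γ).Arc (F Γ) t (G Γ) u := by
  have hpos : ∀ (a : Node q γ) (F : Ctx → ℕ), DefFun F → DefFun fun Γ => pos (F Γ) a :=
    fun a F hF => (hF.mul (.const _)).add (.const _)
  obtain ⟨a, _ | c⟩ := t <;> obtain ⟨b, _ | c'⟩ := u
  · simp only [arc_none_none_iff]
    exact hL.edge hF hG a b
  · simp only [arc_none_some_iff]
    exact (DefPred.eq hF hG).and ((DefPred.const _).and (hL.allowed hF a _).not)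
  · exact (DefPred.const False).congr fun Γ => iff_of_false not_arc_some_none id
  · simp only [arc_some_some_iff]
    exact (DefPred.const _).and ((DefPred.eq (hpos b G hG) ((hpos a F hF).add (.const 1))).or
      ((DefPred.eq hF hG).and ((DefPred.const _).and (DefPred.eq (hpos a F hF) (.const 0)))))

theorem inBag (hF : DefFun F) (hG : DefFun G) (t : Site q γ) :
    DefPred fun Γ => (L Γ).InBag (F Γ) (G Γ, t) :=
  (DefPred.eq hG hF).or ((DefPred.eq hG (hF.add (.const 1))).or ((DefPred.le hF hG).and
    ((DefPred.le hG (hF.add hL.step)).and (.const (∃ j, t = tapeSite q j)))))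

theorem numAdj (hF : DefFun F) (hG : DefFun G) :
    DefPred fun Γ => (L Γ).NumAdj q (F Γ) (G Γ) := by
  have hF' := hF.div (.const (blockSize q γ))
  have hG' := hG.div (.const (blockSize q γ))
  exact DefPred.exists_finite fun t => DefPred.exists_finite fun u =>
    (DefPred.eq (hF.mod (.const _)) (.const _)).and ((DefPred.eq (hG.mod (.const _)) (.const _)).and
      ((hL.arc hF' hG' t u).or (hL.arc hG' hF' u t)))

theorem numInBag (hF : DefFun F) (hG : DefFun G) :
    DefPred fun Γ => (L Γ).NumInBag q (F Γ) (G Γ) :=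
  DefPred.exists_finite fun t => (DefPred.eq (hG.mod (.const _)) (.const _)).and
    (hL.inBag hF (hG.div (.const _)) t)

end IsDefinable

theorem decode_eq_iff {X : ℕ} (u : Fin (X * blockSize q γ)) (t : Site q γ) :
    decode u = (u.val / blockSize q γ, t) ↔
      u.val % blockSize q γ = Fintype.equivFin (Site q γ) t := by
  have h := Equiv.symm_apply_eq (Fintype.equivFin (Site q γ)) (x := u.modNat) (y := t)
  exact ⟨fun hu => congrArg Fin.val (h.1 (congrArg Prod.snd hu)),
    fun hu => Prod.ext rfl (h.2 (Fin.ext hu))⟩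

theorem graph_adj_iff (L : Layout γ) {X : ℕ} (u v : Fin (X * blockSize q γ)) :
    (L.graph q X).Adj u v ↔ L.NumAdj q u v := by
  rw [graph_adj]
  constructor
  · exact fun h => ⟨_, _, (decode_eq_iff u _).1 rfl, (decode_eq_iff v _).1 rfl, h⟩
  · rintro ⟨t, w, hu, hv, h⟩
    rw [(decode_eq_iff u t).2 hu, (decode_eq_iff v w).2 hv]
    exact h

theorem mem_bag_iff (L : Layout γ) {X : ℕ} (i : Fin X) (v : Fin (X * blockSize q γ)) :
    v ∈ L.bag q i ↔ L.NumInBag q i v := by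
  rw [mem_bag]
  constructor
  · exact fun h => ⟨_, (decode_eq_iff v _).1 rfl, h⟩
  · rintro ⟨t, hv, h⟩
    rw [(decode_eq_iff v t).2 hv]
    exact h

end Layout

theorem satLayout_isDefinable (q β γ : ℕ) :
    Layout.IsDefinable fun Γ => satLayout q β γ (Γ.var 0) Γ.inp := by
  have hn : DefFun fun Γ => Γ.var 0 := .var 0
  have hg : DefFun fun Γ => numGroups β (Γ.var 0) := (hn.div (.const β)).add (.const 1)
  have hS : DefFun fun Γ => clauseLength β (Γ.var 0) := (DefFun.const (2 ^ β)).mul hg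
  refine ⟨hg, fun F hF => .eq (hF.mod hS) (.const 0),
    fun F hF => .eq ((hF.add (.const 1)).mod hS) (.const 0), fun F hF => ?_, fun F hF i => ?_⟩
  · have hv : ∀ i : Fin β, DefFun fun Γ => F Γ % numGroups β (Γ.var 0) * β + i.val :=
      fun i => ((hF.mod hg).mul (.const β)).add (.const _)
    exact DefPred.exists_finite fun i => DefPred.exists_finite fun b =>
      (DefPred.lt (hv i) hn).and ((DefPred.eq
        ((((hF.div hg).mod (.const _)).div (.const _)).mod (.const 2)) (.const _)).and
        (DefPred.ne_zero (DefFun.input b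
          ((((hF.div hg).div (.const _)).mul hn).add (hv i)))))
  · exact (((hF.div hg).mod (.const _)).div (.const _)).mod (.const _)

/-! ### The reduction -/

/-- The graph with a path decomposition that belongs to a formula. -/
noncomputable def satGraph (q β γ : ℕ) (φ : CNF) : BaggedGraph :=
  (satLayout q β γ φ.numVars φ.incidence).bagged q
    (φ.numClauses * clauseLength β φ.numVars + 1)

open scoped Classical in
theorem RAM.rowMajor_eq {r c : ℕ} (M : Fin r → Fin c → Prop) (p : ℕ → ℕ → Prop)
    (h : ∀ i j, M i j ↔ p i j) (k : ℕ) :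
    rowMajor M k = if k < r * c then if p (k / c) (k % c) then 1 else 0 else 0 := by
  split_ifs with hk hp
  · have hc : 0 < c := Nat.pos_of_ne_zero fun h => by simp [h] at hk
    have hr : k / c < r := Nat.div_lt_of_lt_mul (by rwa [mul_comm] at hk)
    have h1 := (rowMajor_ne_zero_iff M (k / c) ⟨k % c, Nat.mod_lt _ hc⟩).2
      ⟨hr, (h ⟨_, hr⟩ ⟨_, Nat.mod_lt _ hc⟩).2 hp⟩
    simp only [Nat.div_add_mod'] at h1
    have h2 := rowMajor_le_one M k
    omega
  · have hc : 0 < c := Nat.pos_of_ne_zero fun h => by simp [h] at hk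
    by_contra h0
    rw [← ne_eq, ← Nat.div_add_mod' k c,
      rowMajor_ne_zero_iff M (k / c) ⟨k % c, Nat.mod_lt _ hc⟩] at h0
    obtain ⟨hr, hM⟩ := h0
    exact hp ((h _ _).1 hM)
  · exact rowMajor_eq_zero M (by omega)

/-- The input for the graph is computed from the input for the formula in polynomial time. -/
theorem exists_translation (q γ s d R : ℕ) {β : ℕ} (hβ : 0 < β) (hR : 2 ≤ R) :
    ∃ (P : Prog) (c : ℕ), ∀ φ : CNF, ∃ t s', Exec P ((satProblem s).input φ) t s' ∧
      s'.AgreeBelow R ((coloringProblem q d).input (satGraph q β γ φ)) ∧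
      t ≤ (φ.numVars + φ.numClauses + 2) ^ c ∧
      (coloringProblem q d).size (satGraph q β γ φ) ≤ (φ.numVars + φ.numClauses + 2) ^ c := by
  classical
  have hX : DefFun fun Γ => Γ.var 1 * clauseLength β (Γ.var 0) + 1 :=
    ((DefFun.var 1).mul ((DefFun.const (2 ^ β)).mul (((DefFun.var 0).div (.const β)).add
      (.const 1)))).add (.const 1)
  have hN := hX.mul (.const (Layout.blockSize q γ))
  have hL := satLayout_isDefinable q β γ
  have hA := (hL.numAdj (q := q) ((DefFun.var 2).div hN) ((DefFun.var 2).mod hN)).ite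
  have hB := (hL.numInBag (q := q) ((DefFun.var 2).div hN) ((DefFun.var 2).mod hN)).ite
  obtain ⟨eX, hX⟩ := hX
  obtain ⟨eN, hN⟩ := hN
  obtain ⟨eA, hA⟩ := hA
  obtain ⟨eB, hB⟩ := hB
  obtain ⟨c₁, H⟩ := exec_translate hR eN eX eA eB
  obtain ⟨c₂, HN⟩ := eN.exists_eval_le
  obtain ⟨c₃, HX⟩ := eX.exists_eval_le
  refine ⟨translate R eN eX eA eB, c₁ + (c₂ + c₃ + 1), fun φ => ?_⟩
  set n := φ.numVars with hn
  set m := φ.numClauses with hm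
  obtain ⟨t, s', hexec, h0, h1, hr, ha0, ha1, har, ht⟩ := H n m φ.incidence
    ((satProblem s).input φ) rfl rfl (fun x hx => by
      simp [satProblem, initial, show x ≠ 0 by omega, show x ≠ 1 by omega]) rfl rfl
    (fun a ha => by simp [satProblem, initial, show a ≠ 0 by omega, show a ≠ 1 by omega])
    (fun b i => rowMajor_le_one _ _) (fun b i hi => rowMajor_eq_zero _ hi)
  have vX : eX.eval (.of n m φ.incidence 0) = m * clauseLength β n + 1 := hX _
  have vN : eN.eval (.of n m φ.incidence 0) =
    (m * clauseLength β n + 1) * Layout.blockSize q γ := hN _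
  have hle : (Ctx.of n m φ.incidence 0).Le (n + m + 2) := by
    refine ⟨fun i => ?_, fun b i => (rowMajor_le_one _ _).trans (by omega)⟩
    fin_cases i <;> simp [Ctx.of] <;> omega
  have hV : 2 ≤ n + m + 2 := by omega
  have bN := HN _ _ hV hle
  have bX := HX _ _ hV hle
  rw [vX] at h1 ha1 bX
  rw [vN] at h0 ha0 ha1 bN
  set X := m * clauseLength β n + 1 with hXd
  set N := X * Layout.blockSize q γ with hNd
  have hW : 0 < Layout.blockSize q γ := Fintype.card_pos_iff.2 ⟨(.hub, none)⟩
  -- The output matrices are at least as large as the input matrices, so unwritten cells of the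
  -- output arrays hold 0.
  have hmn : m * n ≤ X := by
    have h1 : β ≤ 2 ^ β := Nat.lt_two_pow_self.le
    have h2 : n ≤ β * (n / β + 1) := by
      have := Nat.div_add_mod n β
      have := Nat.mod_lt n hβ
      rw [mul_add, mul_one]
      omega
    have h3 : n ≤ clauseLength β n := h2.trans (Nat.mul_le_mul_right _ h1)
    exact (Nat.mul_le_mul_left m h3).trans (Nat.le_succ _)
  have hX1 : 1 ≤ X := Nat.le_add_left _ _
  have hXN : X ≤ N := Nat.le_mul_of_pos_right _ hW
  have hNN : m * n ≤ N * N := hmn.trans (hXN.trans (Nat.le_mul_of_pos_left _ (by omega)))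
  have hXN' : m * n ≤ X * N := hmn.trans (Nat.le_mul_of_pos_right _ (by omega))
  have hpow : ∀ c, c ≤ c₁ + (c₂ + c₃ + 1) → (n + m + 2) ^ c ≤ (n + m + 2) ^ (c₁ + (c₂ + c₃ + 1)) :=
    fun c hc => Nat.pow_le_pow_right (by omega) hc
  refine ⟨t, s', hexec, ⟨fun x hx => ?_, fun a ha => ?_⟩, ht.trans (hpow _ (by omega)), ?_⟩
  · rcases x with _ | _ | x
    · exact h0
    · exact h1
    · exact hr _ (by omega) hx
  · rcases a with _ | _ | a
    · rw [ha0]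
      refine funext fun k => Eq.symm ((RAM.rowMajor_eq (r := N) (c := N) _
        ((satLayout q β γ n φ.incidence).NumAdj q) (Layout.graph_adj_iff _ (X := X)) k).trans ?_)
      refine if_ctx_congr Iff.rfl (fun _ => (hA (.of n m φ.incidence k)).symm) fun hk => ?_
      exact (rowMajor_eq_zero _ (hNN.trans (not_lt.1 hk))).symm
    · rw [ha1]
      refine funext fun k => Eq.symm ((RAM.rowMajor_eq (r := X) (c := N) _
        ((satLayout q β γ n φ.incidence).NumInBag q) (Layout.mem_bag_iff _ (X := X)) k).trans ?_)
      refine if_ctx_congr Iff.rfl (fun _ => (hB (.of n m φ.incidence k)).symm) fun hk => ?_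
      exact (rowMajor_eq_zero _ (hXN'.trans (not_lt.1 hk))).symm
    · exact har _ (by omega) ha
  · have h5 := pow_add_pow_le hV c₂ c₃
    calc N + X ≤ (n + m + 2) ^ c₂ + (n + m + 2) ^ c₃ := Nat.add_le_add bN bX
      _ ≤ _ := h5.trans (hpow _ (by omega))

theorem satGraph_colorable_iff {q β γ : ℕ} (hq : 3 ≤ q) (hβ : 0 < β) (hpow : 2 ^ β ≤ q ^ γ)
    (φ : CNF) : (satGraph q β γ φ).graph.Colorable q ↔ φ.Satisfiable :=
  (Layout.graph_colorable_iff _ hq _).trans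
    ⟨fun ⟨_, hf⟩ => satisfiable_of_isListColoring hpow φ hf,
      exists_isListColoring_of_satisfiable hq hβ⟩

/-- Bases that are just good enough to encode assignments by colors. -/
theorem exists_encoding_parameters {q : ℕ} {b : ℝ} (hb : 1 ≤ b) (hbq : b < q) :
    ∃ (β γ : ℕ) (a : ℝ), 0 < β ∧ 2 ^ β ≤ q ^ γ ∧ 1 ≤ a ∧ a < 2 ∧ b ^ γ ≤ a ^ β := by
  have hb0 : 0 < b := by linarith
  -- With `2 * b ^ γ < q ^ γ`, rounding `q ^ γ` down to a power `2 ^ β` still leaves `b ^ γ < 2 ^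
  -- β`. So the `β`-th root `a` of `b ^ γ` is below 2.
  obtain ⟨γ, hγ⟩ := pow_unbounded_of_one_lt 2 ((one_lt_div hb0).2 hbq)
  rw [div_pow, lt_div_iff₀ (by positivity)] at hγ
  have h1 : 1 ≤ b ^ γ := one_le_pow₀ hb
  have hq2 : 2 < q ^ γ := by
    have : (2 : ℝ) < (q : ℝ) ^ γ := by linarith
    exact_mod_cast this
  have hβ : Nat.log 2 (q ^ γ) ≠ 0 := (Nat.log_pos (by norm_num) hq2.le).ne'
  have hlt : b ^ γ < 2 ^ Nat.log 2 (q ^ γ) := by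
    have h2 : ((q ^ γ : ℕ) : ℝ) < ((2 ^ (Nat.log 2 (q ^ γ) + 1) : ℕ) : ℝ) :=
      Nat.cast_lt.2 (Nat.lt_pow_succ_log_self (by norm_num) _)
    push_cast at h2
    rw [pow_succ] at h2
    linarith
  have ha := Real.rpow_inv_natCast_pow (x := b ^ γ) (by positivity) hβ
  refine ⟨Nat.log 2 (q ^ γ), γ, (b ^ γ) ^ ((Nat.log 2 (q ^ γ) : ℝ)⁻¹), Nat.pos_of_ne_zero hβ,
    Nat.pow_log_le_self 2 (by omega), Real.one_le_rpow h1 (by positivity), ?_, ha.ge⟩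
  rw [← ha] at hlt
  exact lt_of_pow_lt_pow_left₀ _ (by norm_num) hlt

theorem ParamProblem.SolvableInOStar.mono {A : ParamProblem} {b b' : ℝ}
    (h : A.SolvableInOStar b) (hb : 0 ≤ b) (hbb : b ≤ b') : A.SolvableInOStar b' := by
  obtain ⟨P, C, c, H⟩ := h
  refine ⟨P, C, c, fun I hI => ?_⟩
  obtain ⟨t, s, he, hs, ht⟩ := H I hI
  refine ⟨t, s, he, hs, ht.trans ?_⟩
  gcongr

/-- A fast algorithm for coloring gives a fast algorithm for satisfiability. -/
theorem satProblem_solvable_of_coloringProblem_solvable {q β γ s : ℕ} {a b : ℝ} (hq : 3 ≤ q)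
    (hβ : 0 < β) (hpow : 2 ^ β ≤ q ^ γ) (ha : 1 ≤ a) (hb : 1 ≤ b) (hab : b ^ γ ≤ a ^ β)
    (h : (coloringProblem q (2 * q - 1)).SolvableInOStar b) : (satProblem s).SolvableInOStar a := by
  obtain ⟨P, C, c, H⟩ := h
  -- All names used by `P` lie below `P.bound + 2`, so `P` does not notice the scratch data left by
  -- the translation.
  obtain ⟨Q, c₁, HQ⟩ := exists_translation q γ s (2 * q - 1) (P.bound + 2) hβ (by omega)
  -- The part of the width that does not depend on the formula: the tape contributes `(n / β + 2) *
  -- γ`, of which `2 * γ` is constant.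
  set e₀ := 2 * Layout.blockSize q γ + 2 * γ with he₀
  obtain ⟨K, hK⟩ := exists_nat_ge (b ^ e₀)
  set c₂ := c₁ + (c₁ + 1) * c with hc₂
  refine ⟨.seq Q P, (1 + C * K) * 2 ^ c₂, c₂, fun φ _ => ?_⟩
  obtain ⟨t₁, s₁, hQ, hag, ht₁, hsize⟩ := HQ φ
  obtain ⟨t₂, s₂, hP, hs₂, ht₂⟩ := H (satGraph q β γ φ)
    ⟨Layout.graph_maxDegree _ hq (Nat.succ_pos _),
      Layout.bagged_isPathDecomposition _ (numGroups_pos _ _) _⟩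
  have hag' : ((coloringProblem q (2 * q - 1)).input (satGraph q β γ φ)).AgreeBelow
      (P.bound + 2) s₁ := ⟨fun x hx => (hag.reg x hx).symm, fun x hx => (hag.arr x hx).symm⟩
  obtain ⟨s₃, hP', hag₃⟩ := hP.of_agreeBelow (Nat.le_add_right _ _) hag'
  refine ⟨_, s₃, hQ.seq hP', ?_, ?_⟩
  · rw [← hag₃.reg 0 (by omega), hs₂]
    exact satGraph_colorable_iff hq hβ hpow φ
  · set n := φ.numVars
    set m := φ.numClauses
    set V : ℝ := (n : ℝ) + m + 2 with hV
    have hV1 : 1 ≤ V := by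
      have : (0 : ℝ) ≤ (n : ℝ) + m := by positivity
      linarith
    have ht₁' : (t₁ : ℝ) ≤ V ^ c₁ := by
      have : (t₁ : ℝ) ≤ (((n + m + 2) ^ c₁ : ℕ) : ℝ) := Nat.cast_le.2 ht₁
      simpa [hV] using this
    have hsize' : ((coloringProblem q (2 * q - 1)).size (satGraph q β γ φ) : ℝ) + 1 ≤
        V ^ (c₁ + 1) := by
      have h1 : ((coloringProblem q (2 * q - 1)).size (satGraph q β γ φ) : ℝ) ≤
        (((n + m + 2) ^ c₁ : ℕ) : ℝ) := Nat.cast_le.2 hsize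
      have h2 : (((n + m + 2) ^ c₁ : ℕ) : ℝ) = V ^ c₁ := by simp [hV]
      have h3 : 1 ≤ V ^ c₁ := one_le_pow₀ hV1
      have h4 : V ^ c₁ * 2 ≤ V ^ c₁ * V := by
        gcongr
        have : (0 : ℝ) ≤ (n : ℝ) + m := by positivity
        linarith
      rw [pow_succ]
      linarith
    have hwidth : b ^ (coloringProblem q (2 * q - 1)).param (satGraph q β γ φ) ≤ K * a ^ n := by
      have hw : (coloringProblem q (2 * q - 1)).param (satGraph q β γ φ) ≤ e₀ + γ * (n / β) := by
        refine (Layout.bagged_width_le _ _).trans (le_of_eq ?_)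
        show 2 * Layout.blockSize q γ + (n / β + 1 + 1) * γ = _
        rw [he₀]
        ring
      calc _ ≤ b ^ (e₀ + γ * (n / β)) := pow_le_pow_right₀ hb hw
        _ = b ^ e₀ * (b ^ γ) ^ (n / β) := by rw [pow_add, pow_mul]
        _ ≤ K * (a ^ β) ^ (n / β) := by gcongr
        _ = K * a ^ (β * (n / β)) := by rw [pow_mul]
        _ ≤ K * a ^ n := by
          gcongr
          exact Nat.mul_div_le n β
    have han : 1 ≤ a ^ n := one_le_pow₀ ha
    have hV2 : V ≤ 2 * ((n : ℝ) + m + 1) := by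
      have : (0 : ℝ) ≤ (n : ℝ) + m := by positivity
      linarith
    have hsz : ((satProblem s).size φ : ℝ) = (n : ℝ) + m := by simp [satProblem, n, m]
    have hpar : (satProblem s).param φ = n := rfl
    rw [hsz, hpar]
    push_cast
    calc (t₁ : ℝ) + t₂ ≤ V ^ c₁ + C * (K * a ^ n) * (V ^ (c₁ + 1)) ^ c := by
          refine add_le_add ht₁' (ht₂.trans ?_)
          gcongr
      _ ≤ a ^ n * V ^ c₂ + C * (K * a ^ n) * V ^ c₂ := by
          rw [← pow_mul]
          gcongr
          · calc V ^ c₁ = 1 * V ^ c₁ := (one_mul _).symm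
              _ ≤ a ^ n * V ^ c₂ := by
                gcongr
                omega
          · omega
      _ = (1 + C * K) * a ^ n * V ^ c₂ := by ring
      _ ≤ (1 + C * K) * a ^ n * (2 * ((n : ℝ) + m + 1)) ^ c₂ := by gcongr
      _ = _ := by rw [mul_pow]; ring

/-- Since every execution takes time, no base `b ≤ 0` is possible when some instance has an odd
parameter. -/
theorem not_coloringProblem_solvable_of_nonpos {q d : ℕ} (hd : Odd d) {b : ℝ} (hb : b ≤ 0) :
    ¬ (coloringProblem q d).SolvableInOStar b := by
  classical
  rintro ⟨P, C, c, H⟩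
  -- The complete graph on `d + 1` vertices in a single bag has both maximum degree and width `d`.
  let I : BaggedGraph := ⟨d + 1, ⊤, 1, fun _ => Finset.univ⟩
  have hw : I.width = d := by
    show (Finset.univ.sup fun _ : Fin 1 => (Finset.univ : Finset (Fin (d + 1))).card) - 1 = d
    simp
  have hdeg : (⊤ : SimpleGraph (Fin (d + 1))).maxDegree = d := by
    have : ∀ v : Fin (d + 1), (⊤ : SimpleGraph (Fin (d + 1))).degree v = d := fun v => by simp
    refine le_antisymm (SimpleGraph.maxDegree_le_of_forall_degree_le _ _ fun v => (this v).le) ?_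
    exact (this 0).ge.trans (SimpleGraph.degree_le_maxDegree _ 0)
  obtain ⟨t, s, he, -, ht⟩ := H I ⟨by convert hdeg,
    ⟨fun v => ⟨0, Finset.mem_univ _⟩, fun u v _ => ⟨0, Finset.mem_univ _, Finset.mem_univ _⟩,
      fun _ _ _ _ _ _ _ _ => Finset.mem_univ _⟩⟩
  have hpar : (coloringProblem q d).param I = d := hw
  rw [hpar] at ht
  have h1 : (1 : ℝ) ≤ t := Nat.one_le_cast.2 he.pos
  have h2 : b ^ d ≤ 0 := hd.pow_nonpos hb
  have h3 : (C : ℝ) * b ^ d * (((coloringProblem q d).size I : ℝ) + 1) ^ c ≤ 0 :=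
    mul_nonpos_of_nonpos_of_nonneg (mul_nonpos_of_nonneg_of_nonpos (by positivity) h2)
      (by positivity)
  linarith

theorem theorem5 (d : ℕ) (hd : 5 ≤ d) (hodd : Odd d) (hSETH : SETH) :
    ¬ ∃ ε : ℝ, 0 < ε ∧
      (coloringProblem (d / 2 + 1) d).SolvableInOStar (((d / 2 + 1 : ℕ) : ℝ) - ε) := by
  rintro ⟨ε, hε, h⟩
  rcases le_or_gt (((d / 2 + 1 : ℕ) : ℝ) - ε) 0 with hb | hb
  · exact not_coloringProblem_solvable_of_nonpos hodd hb h
  have hq : 3 ≤ d / 2 + 1 := by omega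
  have hdq : d = 2 * (d / 2 + 1) - 1 := by
    obtain ⟨k, rfl⟩ := hodd
    omega
  generalize d / 2 + 1 = q at *
  subst hdq
  have hq' : (3 : ℝ) ≤ q := by exact_mod_cast hq
  -- A base between 0 and 1 is raised to 1, since bounding `b ^ pw` through an upper bound on the
  -- width needs `b ≥ 1`.
  have hbq : max ((q : ℝ) - ε) 1 < q := max_lt (by linarith) (by linarith)
  obtain ⟨β, γ, a, hβ, hpow, ha, ha2, hab⟩ := exists_encoding_parameters (le_max_right _ _) hbq
  obtain ⟨s, hs⟩ := hSETH (2 - a) (by linarith)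
  rw [sub_sub_cancel] at hs
  exact hs (satProblem_solvable_of_coloringProblem_solvable hq hβ hpow ha (le_max_right _ _) hab
    (h.mono hb.le (le_max_left _ _)))
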